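/- Let $C^1[0,\infty)$ denote the space of complex-valued continuously differentiable functions on $[0,\infty)$ (one-sided derivative at $0$). For $\tau\in C^1[0,\infty)$ with $\tau'(x)=o(1)$ as $x\to\infty$, let $\mathcal{L}\{\tau;s\}=\int_0^\infty \tau(x)e^{-sx}\,dx$, $\Re s>0$, be its Laplace transform. For $-\infty<\beta<0$, let $V_\beta$ be the space of all $\tau\in C^1[0,\infty)$ with $\tau'(x)=o(1)$ as $x\to\infty$ such that $\mathcal{L}\{\tau;s\}$ has an analytic extension to the half-plane $\{s\in\mathbb{C} : \Re s>\beta\}$. For $\alpha<0$ and $r>0$, let $R_{\alpha,r}=\{s\in\mathbb{C} : \alpha<\Re s<1,\ |\Im s|<r\}$, and let $V_{\alpha,r}$ be the space of all $\tau\in C^1[0,\infty)$ with $\tau'(x)=o(1)$ as $x\to\infty$ such that $\mathcal{L}\{\tau;s\}$ has an analytic continuation to $R_{\alpha,r}$ which extends continuously to the closed rectangle $\overline{R}_{\alpha,r}$, normed by $$\|\tau\|_{\alpha,r}=\sup_{x\ge 0}|\tau'(x)|+\sup_{s\in\overline{R}_{\alpha,r}}|\mathcal{L}\{\tau;s\}|,$$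 where $\mathcal{L}\{\tau;s\}$ also denotes the extension. **Proposition.** For all real $\beta<\alpha<0$ and every $r>0$, one has $V_\beta\subseteq V_{\alpha,r}$, and $V_\beta$ is dense in $V_{\alpha,r}$ with respect to the norm $\|\cdot\|_{\alpha,r}$. -/

import Mathlib

open Set Filter Topology MeasureTheory
open scoped Complex

namespace LaplaceSpaces

noncomputable section

/-- Complex-valued functions on the half-line `[0, ∞)`. -/
abbrev HalfLineFun : Type := Ici (0 : ℝ) → ℂ

/-- The derivative of `τ : [0, ∞) → ℂ` at `x ≥ 0`, one-sided at `x = 0`.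
(`IciExtend τ` is `τ` on `[0, ∞)`; its values on the negative axis play no role here.) -/
def derivHL (τ : HalfLineFun) (x : ℝ) : ℂ := derivWithin (IciExtend τ) (Ici 0) x

/-- `τ ∈ C¹[0, ∞)` and `τ'(x) = o(1)` as `x → ∞`. -/
structure IsC1Vanishing (τ : HalfLineFun) : Prop where
  contDiff : ContDiffOn ℝ 1 (IciExtend τ) (Ici 0)
  tendsto_deriv : Tendsto (derivHL τ) atTop (𝓝 0)

/-- The Laplace transform `∫₀^∞ τ(x) e^{-sx} dx`. For the functions considered here it converges
absolutely if `Re s > 0`, and it is used for such `s` only. -/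
def laplace (τ : HalfLineFun) (s : ℂ) : ℂ :=
  ∫ x in Ioi (0 : ℝ), IciExtend τ x * Complex.exp (-s * x)

/-- The open half-plane `Re s > β`. -/
def halfPlane (β : ℝ) : Set ℂ := {s | β < s.re}

/-- The open rectangle `α < Re s < 1`, `|Im s| < r`. -/
def openRect (α r : ℝ) : Set ℂ := Ioo α 1 ×ℂ Ioo (-r) r

/-- The closed rectangle `α ≤ Re s ≤ 1`, `|Im s| ≤ r`. -/
def closedRect (α r : ℝ) : Set ℂ := Icc α 1 ×ℂ Icc (-r) r

/-- The space `V_β` (for real `β < 0`): functions `τ ∈ C¹[0, ∞)` with `τ' = o(1)` whose Laplace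
transform has an analytic extension to the half-plane `Re s > β`. -/
def halfPlaneSpace (β : ℝ) : Set HalfLineFun :=
  {τ | IsC1Vanishing τ ∧ ∃ F : ℂ → ℂ,
    DifferentiableOn ℂ F (halfPlane β) ∧ ∀ s : ℂ, 0 < s.re → F s = laplace τ s}

/-- `F` is, on the closed rectangle, the continuous extension of an analytic continuation of the
Laplace transform of `τ` to the open rectangle. -/
structure IsRectExtension (α r : ℝ) (τ : HalfLineFun) (F : ℂ → ℂ) : Prop where
  differentiableOn : DifferentiableOn ℂ F (openRect α r)
  continuousOn : ContinuousOn F (closedRect α r)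
  eq_laplace : ∀ s ∈ openRect α r, 0 < s.re → F s = laplace τ s

/-! ### Elementary facts needed for the vector space structure and the norm -/

lemma IsC1Vanishing.differentiableOn {τ : HalfLineFun} (h : IsC1Vanishing τ) :
    DifferentiableOn ℝ (IciExtend τ) (Ici 0) := h.contDiff.differentiableOn (by norm_num)

lemma IsC1Vanishing.continuousOn_deriv {τ : HalfLineFun} (h : IsC1Vanishing τ) :
    ContinuousOn (derivHL τ) (Ici 0) :=
  h.contDiff.continuousOn_derivWithin (uniqueDiffOn_Ici 0) le_rfl

lemma derivHL_add {τ σ : HalfLineFun} (h : IsC1Vanishing τ) (k : IsC1Vanishing σ) {x : ℝ}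
    (hx : 0 ≤ x) : derivHL (τ + σ) x = derivHL τ x + derivHL σ x :=
  derivWithin_add (h.differentiableOn x hx) (k.differentiableOn x hx)

lemma derivHL_smul {τ : HalfLineFun} (c : ℂ) (x : ℝ) : derivHL (c • τ) x = c * derivHL τ x :=
  derivWithin_const_smul_field (𝕜 := ℝ) c (IciExtend τ)

lemma derivHL_zero (x : ℝ) : derivHL 0 x = 0 := by
  have := derivHL_smul (τ := 0) 0 x
  simpa using this

lemma IsC1Vanishing.zero : IsC1Vanishing 0 where
  contDiff := contDiffOn_const (c := (0 : ℂ))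
  tendsto_deriv := by
    rw [show derivHL 0 = fun _ => 0 from funext derivHL_zero]
    exact tendsto_const_nhds

lemma IsC1Vanishing.add {τ σ : HalfLineFun} (h : IsC1Vanishing τ) (k : IsC1Vanishing σ) :
    IsC1Vanishing (τ + σ) where
  contDiff := h.contDiff.add k.contDiff
  tendsto_deriv := by
    have := h.tendsto_deriv.add k.tendsto_deriv
    rw [add_zero] at this
    refine this.congr' ?_
    filter_upwards [eventually_ge_atTop 0] with x hx
    rw [derivHL_add h k hx]

lemma IsC1Vanishing.smul {τ : HalfLineFun} (c : ℂ) (h : IsC1Vanishing τ) :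
    IsC1Vanishing (c • τ) where
  contDiff := contDiffOn_const.mul h.contDiff
  tendsto_deriv := by
    have := h.tendsto_deriv.const_mul c
    rw [mul_zero] at this
    exact this.congr fun x => (derivHL_smul c x).symm

lemma IsC1Vanishing.exists_bound {τ : HalfLineFun} (h : IsC1Vanishing τ) :
    ∃ C, ∀ x, 0 ≤ x → ‖derivHL τ x‖ ≤ C := by
  obtain ⟨M, hM⟩ := eventually_atTop.1 (h.tendsto_deriv.norm.eventually (ge_mem_nhds
    (show ‖(0 : ℂ)‖ < 1 by simp)))
  obtain ⟨C, hC⟩ := (isCompact_Icc (a := (0 : ℝ)) (b := M)).exists_bound_of_continuousOn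
    (h.continuousOn_deriv.mono Icc_subset_Ici_self)
  refine ⟨max C 1, fun x hx => ?_⟩
  rcases le_total x M with hx' | hx'
  · exact (hC x ⟨hx, hx'⟩).trans (le_max_left _ _)
  · exact (hM x hx').trans (le_max_right _ _)

lemma IsC1Vanishing.exists_growth {τ : HalfLineFun} (h : IsC1Vanishing τ) :
    ∃ A C, ∀ x, 0 ≤ x → ‖IciExtend τ x‖ ≤ A + C * x := by
  obtain ⟨C, hC⟩ := h.exists_bound
  refine ⟨‖IciExtend τ 0‖, C, fun x hx => ?_⟩
  have := (convex_Ici (0 : ℝ)).norm_image_sub_le_of_norm_derivWithin_le (x := 0) (y := x)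
    h.differentiableOn (fun y hy => hC y hy) self_mem_Ici hx
  rw [sub_zero, Real.norm_of_nonneg hx] at this
  have h2 := norm_le_norm_add_norm_sub' (IciExtend τ x) (IciExtend τ 0)
  linarith

lemma IsC1Vanishing.integrableOn {τ : HalfLineFun} (h : IsC1Vanishing τ) {s : ℂ}
    (hs : 0 < s.re) :
    IntegrableOn (fun x : ℝ => IciExtend τ x * Complex.exp (-s * x)) (Ioi 0) := by
  obtain ⟨A, C, hg⟩ := h.exists_growth
  refine (integrableOn_Ici_iff_integrableOn_Ioi (by finiteness)).1 <|
    (ContinuousOn.locallyIntegrableOn ?_ measurableSet_Ici).integrableOn_of_isBigO_atTop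
      (g := fun x : ℝ => Real.exp (-(s.re / 2) * x)) ?_
      ⟨Ioi 0, Ioi_mem_atTop 0, exp_neg_integrableOn_Ioi 0 (half_pos hs)⟩
  · exact h.differentiableOn.continuousOn.mul (by fun_prop)
  · have h1 : (fun x : ℝ => IciExtend τ x) =O[atTop] fun x : ℝ => Real.exp (s.re / 2 * x) := by
      have h2 : (fun x : ℝ => A + C * x) =O[atTop] fun x : ℝ => Real.exp (s.re / 2 * x) := by
        have h3 := (isLittleO_pow_exp_pos_mul_atTop 0 (half_pos hs)).isBigO
        have h4 := (isLittleO_pow_exp_pos_mul_atTop 1 (half_pos hs)).isBigO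
        have := (h3.const_mul_left A).add (h4.const_mul_left C)
        simpa using this
      refine Asymptotics.IsBigO.trans (Asymptotics.IsBigO.of_bound 1 ?_) h2
      filter_upwards [eventually_ge_atTop 0] with x hx
      rw [one_mul]
      exact (hg x hx).trans (le_abs_self _)
    have h5 : (fun x : ℝ => Complex.exp (-s * x)) =O[atTop] fun x : ℝ => Real.exp (-s.re * x) := by
      refine Asymptotics.IsBigO.of_bound 1 (Eventually.of_forall fun x => ?_)
      simp [Complex.norm_exp]
    refine (h1.mul h5).congr_right fun x => ?_
    rw [← Real.exp_add]
    congr 1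
    ring

lemma laplace_add {τ σ : HalfLineFun} (h : IsC1Vanishing τ) (k : IsC1Vanishing σ) {s : ℂ}
    (hs : 0 < s.re) : laplace (τ + σ) s = laplace τ s + laplace σ s := by
  unfold laplace
  rw [← integral_add (h.integrableOn hs) (k.integrableOn hs)]
  refine integral_congr_ae (Eventually.of_forall fun x => ?_)
  exact add_mul _ _ _

lemma laplace_smul (τ : HalfLineFun) (c s : ℂ) : laplace (c • τ) s = c * laplace τ s := by
  unfold laplace
  rw [← integral_const_mul]
  refine integral_congr_ae (Eventually.of_forall fun x => ?_)
  exact mul_assoc _ _ _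

lemma laplace_const (c s : ℂ) (hs : 0 < s.re) : laplace (fun _ => c) s = c / s := by
  have h : laplace (fun _ => c) s = c * ∫ x in Ioi (0 : ℝ), Complex.exp (-s * x) := by
    unfold laplace
    rw [← integral_const_mul]
    rfl
  rw [h, integral_exp_mul_complex_Ioi (by simpa using hs)]
  simp [div_eq_mul_inv]

lemma isOpen_openRect (α r : ℝ) : IsOpen (openRect α r) := isOpen_Ioo.reProdIm isOpen_Ioo

lemma isCompact_closedRect (α r : ℝ) : IsCompact (closedRect α r) :=
  isCompact_Icc.reProdIm isCompact_Icc

lemma closure_openRect {α r : ℝ} (hα : α < 0) (hr : 0 < r) :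
    closure (openRect α r) = closedRect α r := by
  rw [openRect, Complex.closure_reProdIm, closure_Ioo (by linarith), closure_Ioo (by linarith)]
  rfl

lemma half_mem_openRect {α r : ℝ} (hα : α < 0) (hr : 0 < r) : (1 / 2 : ℂ) ∈ openRect α r := by
  rw [openRect, Complex.mem_reProdIm]
  norm_num
  constructor <;> linarith

lemma isPreconnected_openRect (α r : ℝ) : IsPreconnected (openRect α r) :=
  (((convex_Ioo α 1).linear_preimage Complex.reLm).inter
    ((convex_Ioo (-r) r).linear_preimage Complex.imLm)).isPreconnected

lemma IsRectExtension.unique {α r : ℝ} (hα : α < 0) (hr : 0 < r) {τ : HalfLineFun}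
    {F G : ℂ → ℂ} (hF : IsRectExtension α r τ F) (hG : IsRectExtension α r τ G) :
    EqOn F G (closedRect α r) := by
  have h1 : EqOn F G (openRect α r) := by
    refine (hF.differentiableOn.analyticOnNhd
      (isOpen_openRect α r)).eqOn_of_preconnected_of_eventuallyEq
      (hG.differentiableOn.analyticOnNhd (isOpen_openRect α r)) (isPreconnected_openRect α r)
      (half_mem_openRect hα hr) ?_
    filter_upwards [(isOpen_openRect α r).mem_nhds (half_mem_openRect hα hr),
      (isOpen_lt continuous_const Complex.continuous_re).mem_nhds
        (show (0 : ℝ) < (1 / 2 : ℂ).re by norm_num)] with s hs hs'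
    rw [hF.eq_laplace s hs hs', hG.eq_laplace s hs hs']
  have hcl := closure_openRect hα hr
  exact h1.of_subset_closure hF.continuousOn hG.continuousOn
    (by rw [← hcl]; exact subset_closure) hcl.ge

lemma IsRectExtension.add {α r : ℝ} {τ σ : HalfLineFun} {F G : ℂ → ℂ}
    (h : IsC1Vanishing τ) (k : IsC1Vanishing σ)
    (hF : IsRectExtension α r τ F) (hG : IsRectExtension α r σ G) :
    IsRectExtension α r (τ + σ) (fun s => F s + G s) where
  differentiableOn := hF.differentiableOn.add hG.differentiableOn
  continuousOn := hF.continuousOn.add hG.continuousOn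
  eq_laplace s hs hs' := by
    rw [laplace_add h k hs', hF.eq_laplace s hs hs', hG.eq_laplace s hs hs']

lemma IsRectExtension.smul {α r : ℝ} {τ : HalfLineFun} {F : ℂ → ℂ} (c : ℂ)
    (hF : IsRectExtension α r τ F) : IsRectExtension α r (c • τ) (fun s => c * F s) where
  differentiableOn := hF.differentiableOn.const_mul c
  continuousOn := continuousOn_const.mul hF.continuousOn
  eq_laplace s hs hs' := by rw [laplace_smul, hF.eq_laplace s hs hs']

/-- The functions that make up `V_{α,r}`: those `τ ∈ C¹[0, ∞)` with `τ' = o(1)` whose Laplace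
transform has an analytic continuation to the open rectangle that extends continuously to the
closed rectangle. -/
def rectSubmodule (α r : ℝ) : Submodule ℂ HalfLineFun where
  carrier := {τ | IsC1Vanishing τ ∧ ∃ F : ℂ → ℂ, IsRectExtension α r τ F}
  zero_mem' := by
    refine ⟨.zero, 0, differentiableOn_const 0, continuousOn_const, fun s _ hs => ?_⟩
    have := laplace_const 0 s hs
    rw [zero_div] at this
    exact this.symm
  add_mem' := by
    rintro τ σ ⟨h, F, hF⟩ ⟨k, G, hG⟩
    exact ⟨h.add k, _, hF.add h k hG⟩
  smul_mem' := by
    rintro c τ ⟨h, F, hF⟩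
    exact ⟨h.smul c, _, hF.smul c⟩

/-- The space `V_{α,r}` (`α < 0`, `r > 0`) as a type of its own: it carries the topology of the norm
below, not the topology of pointwise convergence. -/
def RectSpace (α r : ℝ) (_hα : α < 0) (_hr : 0 < r) : Type := rectSubmodule α r

namespace RectSpace

variable {α r : ℝ} {hα : α < 0} {hr : 0 < r}

instance : AddCommGroup (RectSpace α r hα hr) := inferInstanceAs (AddCommGroup (rectSubmodule α r))

instance : Module ℂ (RectSpace α r hα hr) := inferInstanceAs (Module ℂ (rectSubmodule α r))

/-- The underlying function on `[0, ∞)`. -/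
def toFun (τ : RectSpace α r hα hr) : HalfLineFun := Subtype.val τ

/-- The extension of the Laplace transform to the closed rectangle; it is unique there. -/
def ext (τ : RectSpace α r hα hr) : ℂ → ℂ := (Subtype.property τ).2.choose

/-- The norm `‖τ‖_{α,r} = sup_{x ≥ 0} |τ'(x)| + sup_{s} |ℒ{τ; s}|`, where `s` ranges over the closed
rectangle. Both suprema are of bounded families. -/
instance : Norm (RectSpace α r hα hr) where
  norm τ := (⨆ x : Ici (0 : ℝ), ‖derivHL τ.toFun x‖) + ⨆ s : closedRect α r, ‖τ.ext s‖

lemma norm_def (τ : RectSpace α r hα hr) :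
    ‖τ‖ = (⨆ x : Ici (0 : ℝ), ‖derivHL τ.toFun x‖) + ⨆ s : closedRect α r, ‖τ.ext s‖ := rfl

lemma isC1 (τ : RectSpace α r hα hr) : IsC1Vanishing τ.toFun := (Subtype.property τ).1

lemma isExt (τ : RectSpace α r hα hr) : IsRectExtension α r τ.toFun τ.ext :=
  (Subtype.property τ).2.choose_spec

lemma ext_add (τ σ : RectSpace α r hα hr) :
    EqOn (τ + σ).ext (fun s => τ.ext s + σ.ext s) (closedRect α r) :=
  (τ + σ).isExt.unique hα hr (τ.isExt.add τ.isC1 σ.isC1 σ.isExt)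

lemma ext_smul (c : ℂ) (τ : RectSpace α r hα hr) :
    EqOn (c • τ).ext (fun s => c * τ.ext s) (closedRect α r) :=
  (c • τ).isExt.unique hα hr (τ.isExt.smul c)

lemma bddAbove_deriv (τ : RectSpace α r hα hr) :
    BddAbove (range fun x : Ici (0 : ℝ) => ‖derivHL τ.toFun x‖) := by
  obtain ⟨C, hC⟩ := τ.isC1.exists_bound
  exact ⟨C, by rintro _ ⟨x, rfl⟩; exact hC x x.2⟩

lemma bddAbove_ext (τ : RectSpace α r hα hr) :
    BddAbove (range fun s : closedRect α r => ‖τ.ext s‖) := by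
  obtain ⟨C, hC⟩ := (isCompact_closedRect α r).exists_bound_of_continuousOn τ.isExt.continuousOn
  exact ⟨C, by rintro _ ⟨x, rfl⟩; exact hC x x.2⟩

lemma deriv_le (τ : RectSpace α r hα hr) (x : Ici (0 : ℝ)) :
    ‖derivHL τ.toFun x‖ ≤ ⨆ x : Ici (0 : ℝ), ‖derivHL τ.toFun x‖ :=
  le_ciSup τ.bddAbove_deriv x

lemma ext_le (τ : RectSpace α r hα hr) (s : closedRect α r) :
    ‖τ.ext s‖ ≤ ⨆ s : closedRect α r, ‖τ.ext s‖ :=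
  le_ciSup τ.bddAbove_ext s

lemma nonempty_closedRect (hα : α < 0) (hr : 0 < r) : Nonempty (closedRect α r) :=
  ⟨⟨1 / 2, closure_openRect hα hr ▸ subset_closure (half_mem_openRect hα hr)⟩⟩

lemma eq_zero_of_norm_eq_zero (τ : RectSpace α r hα hr) (h : ‖τ‖ = 0) : τ = 0 := by
  have h1 : 0 ≤ ⨆ x : Ici (0 : ℝ), ‖derivHL τ.toFun x‖ := Real.iSup_nonneg fun _ => norm_nonneg _
  have h2 : 0 ≤ ⨆ s : closedRect α r, ‖τ.ext s‖ := Real.iSup_nonneg fun _ => norm_nonneg _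
  rw [norm_def] at h
  have hd : ∀ x : Ici (0 : ℝ), ‖derivHL τ.toFun x‖ ≤ 0 := fun x => by
    linarith [τ.deriv_le x]
  have hmem := half_mem_openRect hα hr
  have he : τ.ext (1 / 2) = 0 := norm_le_zero_iff.1 (by
    linarith [τ.ext_le ⟨1 / 2, closure_openRect hα hr ▸ subset_closure hmem⟩])
  have hre : 0 < (1 / 2 : ℂ).re := by norm_num
  have hc : τ.toFun = fun _ => IciExtend τ.toFun 0 := by
    funext x
    have := (convex_Ici (0 : ℝ)).norm_image_sub_le_of_norm_derivWithin_le (x := (0 : ℝ))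
      (y := (x : ℝ)) τ.isC1.differentiableOn (fun y hy => hd ⟨y, hy⟩) self_mem_Ici x.2
    rw [zero_mul, norm_le_zero_iff, sub_eq_zero, IciExtend_coe] at this
    exact this
  rw [τ.isExt.eq_laplace _ hmem hre, hc, laplace_const _ _ hre] at he
  have h0 : IciExtend τ.toFun 0 = 0 := by simpa using he
  rw [h0] at hc
  exact Subtype.ext hc

lemma core : NormedSpace.Core ℂ (RectSpace α r hα hr) where
  norm_nonneg τ := add_nonneg (Real.iSup_nonneg fun _ => norm_nonneg _)
    (Real.iSup_nonneg fun _ => norm_nonneg _)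
  norm_smul c τ := by
    rw [norm_def, norm_def, mul_add, Real.mul_iSup_of_nonneg (norm_nonneg c),
      Real.mul_iSup_of_nonneg (norm_nonneg c)]
    congr 1
    · refine congrArg _ (funext fun x => ?_)
      rw [← norm_mul, ← derivHL_smul]
      rfl
    · refine congrArg _ (funext fun s => ?_)
      rw [ext_smul c τ s.2, norm_mul]
  norm_triangle τ σ := by
    have := nonempty_closedRect hα hr
    rw [norm_def, norm_def, norm_def, add_add_add_comm]
    refine add_le_add (ciSup_le fun x => ?_) (ciSup_le fun s => ?_)
    · have h : derivHL (τ + σ).toFun x = derivHL τ.toFun x + derivHL σ.toFun x :=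
        derivHL_add τ.isC1 σ.isC1 x.2
      rw [h]
      exact (norm_add_le _ _).trans (add_le_add (τ.deriv_le x) (σ.deriv_le x))
    · rw [ext_add τ σ s.2]
      exact (norm_add_le _ _).trans (add_le_add (τ.ext_le s) (σ.ext_le s))
  norm_eq_zero_iff τ := by
    refine ⟨τ.eq_zero_of_norm_eq_zero, ?_⟩
    rintro rfl
    have h : ∀ x : ℝ, derivHL (0 : RectSpace α r hα hr).toFun x = 0 := derivHL_zero
    have h' : ∀ s : closedRect α r, (0 : RectSpace α r hα hr).ext s = 0 := fun s => by
      have := ext_smul 0 (0 : RectSpace α r hα hr) s.2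
      simpa using this
    simp [norm_def, h, h']

instance : NormedAddCommGroup (RectSpace α r hα hr) := NormedAddCommGroup.ofCore core

instance : NormedSpace ℂ (RectSpace α r hα hr) := NormedSpace.ofCore core

end RectSpace

end

end LaplaceSpaces

/-! By Hahn–Banach it is enough that a bounded functional Λ on V_{α,r} which annihilates V_β is
zero. The tool is the resolvent of D = d/dx: the solution U of (z - D)U = σ with U(0) = c, called
`evolve z c σ`, has Laplace transform (c - ℒσ(s))/(s - z). If Re z < 0, then U' → 0 for every c. If
z is off the closed rectangle, the pole is harmless for every c; if ℒσ continues analytically to F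
near z, the choice c = F(z) removes it.

For σ = 0 and c = 1 the solution is e^{zx}, which lies in V_β when Re z < β. Thus Λ(e^{zx}) vanishes
there, and by the identity theorem on the whole connected set {Re z < 0} minus the rectangle
(`apply_evolve_one_eq_zero`). On that set Λ((z - D)⁻¹σ) therefore does not depend on c.

Let σ decay exponentially, with ℒσ analytic on an open Ω containing the rectangle and a half-plane
Re z > -η. Taking c = F(z) on Ω and c = 0 elsewhere glues z ↦ Λ((z - D)⁻¹σ) into an entire function
(`differentiable_resolventFun`). It is bounded and tends to 0 along the positive axis, so it is zero
by Liouville (`resolventFun_eq_zero`). Since x(x - D)⁻¹σ → σ in norm as x → +∞, Λσ = 0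
(`apply_eq_zero_of_isDecayingPair`).

A general τ reduces to such σ in two steps: a dilation x ↦ τ(cx) with c > 1 makes the transform
analytic near the closed rectangle, and a factor e^{-ηx} then gives decay. Both are small
perturbations in norm because τ' = o(1). -/

namespace LaplaceSpaces

/-! ### The initial value problem U' = zU - h -/

/-- The solution of `U' = z U - h`, `U 0 = c`. -/
noncomputable def duhamel (z c : ℂ) (h : ℝ → ℂ) (x : ℝ) : ℂ :=
  Complex.exp (z * x) * (c - ∫ y in (0 : ℝ)..x, Complex.exp (-z * y) * h y)

lemma duhamel_apply_zero (z c : ℂ) (h : ℝ → ℂ) : duhamel z c h 0 = c := by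
  simp [duhamel]

lemma hasDerivAt_cexp_mul (z : ℂ) (x : ℝ) :
    HasDerivAt (fun x : ℝ => Complex.exp (z * x)) (z * Complex.exp (z * x)) x := by
  have := ((Complex.ofRealCLM.hasDerivAt (x := x)).const_mul z).cexp
  simpa [mul_comm] using this

lemma cexp_mul_cexp_neg (z : ℂ) (x : ℝ) :
    Complex.exp (z * x) * Complex.exp (-z * x) = 1 := by
  rw [← Complex.exp_add]; simp

lemma hasDerivAt_duhamel (z c : ℂ) {h : ℝ → ℂ} (hh : Continuous h) (x : ℝ) :
    HasDerivAt (duhamel z c h) (z * duhamel z c h x - h x) x := by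
  have hc : Continuous fun y : ℝ => Complex.exp (-z * y) * h y := by fun_prop
  have h1 := (hc.integral_hasStrictDerivAt 0 x).hasDerivAt.const_sub c
  refine ((hasDerivAt_cexp_mul z x).mul h1).congr_deriv ?_
  have := cexp_mul_cexp_neg z x
  unfold duhamel
  linear_combination (-h x) * this

lemma duhamel_congr {z c : ℂ} {h k : ℝ → ℂ} (hk : EqOn h k (Ici 0)) {x : ℝ} (hx : 0 ≤ x) :
    duhamel z c h x = duhamel z c k x := by
  unfold duhamel
  congr 2
  refine intervalIntegral.integral_congr fun y hy => ?_
  rw [uIcc_of_le hx] at hy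
  simp only [hk (mem_Ici.2 hy.1)]

/-- Uniqueness for the initial value problem `f' = z f - h`. -/
lemma eq_duhamel {z : ℂ} {f h : ℝ → ℂ} (hf : ContinuousOn f (Ici 0))
    (hh : ContinuousOn h (Ici 0)) (hd : ∀ x, 0 < x → HasDerivAt f (z * f x - h x) x)
    {x : ℝ} (hx : 0 ≤ x) : f x = duhamel z (f 0) h x := by
  have hsub : Icc 0 x ⊆ Ici (0 : ℝ) := Icc_subset_Ici_self
  have key := intervalIntegral.integral_eq_sub_of_hasDerivAt_of_le hx
    (f := fun y : ℝ => -(Complex.exp (-z * y) * f y))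
    (f' := fun y : ℝ => Complex.exp (-z * y) * h y)
    (by have := hf.mono hsub; fun_prop)
    (fun y hy => by
      refine ((hasDerivAt_cexp_mul (-z) y).mul (hd y hy.1)).neg.congr_deriv ?_
      ring)
    (ContinuousOn.intervalIntegrable (by
      rw [uIcc_of_le hx]; have := hh.mono hsub; fun_prop))
  unfold duhamel
  rw [key]
  have := cexp_mul_cexp_neg z x
  simp only [Complex.ofReal_zero, mul_zero, Complex.exp_zero, one_mul]
  linear_combination (-f x) * this

lemma duhamel_const_mul (z c a : ℂ) (h : ℝ → ℂ) (x : ℝ) :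
    duhamel z (a * c) (fun y => a * h y) x = a * duhamel z c h x := by
  unfold duhamel
  have : (fun y : ℝ => Complex.exp (-z * y) * (a * h y)) =
      fun y : ℝ => a * (Complex.exp (-z * y) * h y) := by
    funext y; ring
  rw [this, intervalIntegral.integral_const_mul]
  ring

lemma duhamel_eq_add (z c : ℂ) (h : ℝ → ℂ) (x : ℝ) :
    duhamel z c h x = duhamel z 0 h x + c * duhamel z 1 0 x := by
  simp [duhamel]; ring

lemma continuous_duhamel (z c : ℂ) {h : ℝ → ℂ} (hh : Continuous h) :
    Continuous (duhamel z c h) :=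
  continuous_iff_continuousAt.2 fun x => (hasDerivAt_duhamel z c hh x).continuousAt

/-- The resolvent identity: the difference of the two solutions solves the equation at z with
right-hand side (w - z) times the solution at w, and uniqueness applies. The condition on `e`
matches the initial values. -/
lemma duhamel_sub_duhamel {z w c d e : ℂ} {h : ℝ → ℂ} (hh : Continuous h)
    (he : (w - z) * e = c - d) {x : ℝ} (hx : 0 ≤ x) :
    duhamel z c h x - duhamel w d h x = (w - z) * duhamel z e (duhamel w d h) x := by
  have key := eq_duhamel (z := z) (f := fun x => duhamel z c h x - duhamel w d h x)
    (h := fun x => (w - z) * duhamel w d h x)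
    (((continuous_duhamel z c hh).sub (continuous_duhamel w d hh)).continuousOn)
    ((continuous_const.mul (continuous_duhamel w d hh)).continuousOn)
    (fun x _ => ((hasDerivAt_duhamel z c hh x).sub (hasDerivAt_duhamel w d hh x)).congr_deriv
      (by ring)) hx
  simp only [duhamel_apply_zero] at key
  rw [key, ← he, duhamel_const_mul]

lemma norm_cexp_mul (z : ℂ) (x : ℝ) : ‖Complex.exp (z * x)‖ = Real.exp (z.re * x) := by
  simp [Complex.norm_exp]

/-- Restarting the initial value problem at the time `a`. -/
lemma duhamel_add_time (z c : ℂ) {h : ℝ → ℂ} (hh : ContinuousOn h (Ici 0)) {a t : ℝ}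
    (ha : 0 ≤ a) (ht : 0 ≤ t) :
    duhamel z c h (a + t) = duhamel z (duhamel z c h a) (fun y => h (a + y)) t := by
  have hint : ∀ b d, 0 ≤ b → 0 ≤ d → IntervalIntegrable
      (fun y : ℝ => Complex.exp (-z * y) * h y) volume b d := fun b d hb hd => by
    refine ContinuousOn.intervalIntegrable ?_
    have : ContinuousOn h (uIcc b d) := hh.mono fun y hy => (le_min hb hd).trans hy.1
    fun_prop
  have h1 := intervalIntegral.integral_add_adjacent_intervals
    (hint 0 a le_rfl ha) (hint a (a + t) ha (by positivity))
  have h2 : ∫ y in a..(a + t), Complex.exp (-z * y) * h y =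
      Complex.exp (-z * a) * ∫ y in (0 : ℝ)..t, Complex.exp (-z * y) * h (a + y) := by
    have := intervalIntegral.integral_comp_add_left (a := 0) (b := t)
      (fun y : ℝ => Complex.exp (-z * y) * h y) a
    rw [add_zero] at this
    rw [← this, ← intervalIntegral.integral_const_mul]
    refine intervalIntegral.integral_congr fun y _ => ?_
    rw [← mul_assoc, ← Complex.exp_add]
    push_cast
    ring_nf
  have h3 : Complex.exp (z * (a + t : ℝ)) = Complex.exp (z * a) * Complex.exp (z * t) := by
    rw [← Complex.exp_add]; push_cast; ring_nf
  unfold duhamel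
  rw [← h1, h2, h3]
  have := cexp_mul_cexp_neg z a
  linear_combination (-Complex.exp (z * t) *
    ∫ y in (0 : ℝ)..t, Complex.exp (-z * y) * h (a + y)) * this

lemma norm_duhamel_le {z c : ℂ} (hz : z.re < 0) {h : ℝ → ℂ} {B : ℝ}
    (hB : ∀ y, 0 ≤ y → ‖h y‖ ≤ B) {x : ℝ} (hx : 0 ≤ x) :
    ‖duhamel z c h x‖ ≤ ‖c‖ * Real.exp (z.re * x) + B / (-z.re) := by
  have hB0 : 0 ≤ B := (norm_nonneg _).trans (hB 0 le_rfl)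
  have h1 : ‖∫ y in (0 : ℝ)..x, Complex.exp (-z * y) * h y‖ ≤
      ∫ y in (0 : ℝ)..x, Real.exp (-z.re * y) * B := by
    refine intervalIntegral.norm_integral_le_of_norm_le hx
      (Eventually.of_forall fun y hy => ?_) (Continuous.intervalIntegrable (by fun_prop) _ _)
    rw [norm_mul, norm_cexp_mul, Complex.neg_re]
    gcongr
    exact hB y hy.1.le
  have hz' : -z.re ≠ 0 := by linarith
  have h2 : ∫ y in (0 : ℝ)..x, Real.exp (-z.re * y) * B =
      (Real.exp (-z.re * x) - 1) / (-z.re) * B := by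
    rw [intervalIntegral.integral_mul_const,
      intervalIntegral.integral_comp_mul_left (fun y => Real.exp y) hz', integral_exp]
    simp [div_eq_inv_mul]
  have h3 : Real.exp (z.re * x) * Real.exp (-z.re * x) = 1 := by
    rw [← Real.exp_add]; simp
  have h4 : 0 ≤ B / (-z.re) := div_nonneg hB0 (by linarith)
  calc ‖duhamel z c h x‖
      ≤ Real.exp (z.re * x) * (‖c‖ + (Real.exp (-z.re * x) - 1) / (-z.re) * B) := by
        unfold duhamel
        rw [norm_mul, norm_cexp_mul]
        gcongr
        exact (norm_sub_le _ _).trans (by rw [← h2]; gcongr)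
    _ = ‖c‖ * Real.exp (z.re * x) + (1 - Real.exp (z.re * x)) * (B / (-z.re)) := by
        linear_combination (B / (-z.re)) * h3
    _ ≤ _ := by nlinarith [Real.exp_pos (z.re * x)]

/-- Restart the problem at a late time `a`, after which h is small. The contribution of the new
initial value dies like e^{Re z t}, and the rest is bounded by sup |h| / (-Re z). -/
lemma tendsto_duhamel {z c : ℂ} (hz : z.re < 0) {h : ℝ → ℂ} (hh : ContinuousOn h (Ici 0))
    (h0 : Tendsto h atTop (𝓝 0)) : Tendsto (duhamel z c h) atTop (𝓝 0) := by
  refine Metric.tendsto_atTop.2 fun ε hε => ?_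
  have hz' : 0 < -z.re := by linarith
  obtain ⟨N, hN⟩ := Metric.tendsto_atTop.1 h0 (ε / 2 * (-z.re)) (by positivity)
  set a := max N 0
  have ha : 0 ≤ a := le_max_right _ _
  have hb : ∀ y, 0 ≤ y → ‖h (a + y)‖ ≤ ε / 2 * (-z.re) := fun y hy => by
    have := hN (a + y) ((le_max_left _ _).trans (le_add_of_nonneg_right hy))
    rw [dist_zero_right] at this
    exact this.le
  have hexp : Tendsto (fun t : ℝ => ‖duhamel z c h a‖ * Real.exp (z.re * t)) atTop (𝓝 0) := by
    have := (Real.tendsto_exp_atBot.comp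
      (tendsto_id.const_mul_atTop_of_neg hz)).const_mul ‖duhamel z c h a‖
    simpa using this
  obtain ⟨t₀, ht₀⟩ := eventually_atTop.1 (hexp.eventually (gt_mem_nhds (half_pos hε)))
  refine ⟨a + max t₀ 0, fun x hx => ?_⟩
  have ht : max t₀ 0 ≤ x - a := by linarith
  have ht' : 0 ≤ x - a := (le_max_right _ _).trans ht
  have h1 := duhamel_add_time z c hh ha ht'
  rw [add_sub_cancel] at h1
  have h2 := norm_duhamel_le (c := duhamel z c h a) hz hb ht'
  have h3 := ht₀ (x - a) ((le_max_left _ _).trans ht)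
  rw [mul_div_cancel_right₀ _ hz'.ne'] at h2
  rw [dist_zero_right, h1]
  linarith

/-! ### The exponentially decaying solution -/

lemma integrableOn_cexp_mul {z : ℂ} {η C : ℝ} (hz : -η < z.re) {h : ℝ → ℂ}
    (hh : ContinuousOn h (Ici 0)) (hC : ∀ y, 0 ≤ y → ‖h y‖ ≤ C * Real.exp (-η * y)) :
    IntegrableOn (fun y : ℝ => Complex.exp (-z * y) * h y) (Ioi 0) := by
  have hlt : -(z.re + η) < 0 := by linarith
  refine Integrable.mono' ((integrableOn_exp_mul_Ioi hlt 0).const_mul C)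
    (ContinuousOn.aestronglyMeasurable (by
      have := hh.mono Ioi_subset_Ici_self; fun_prop) measurableSet_Ioi) ?_
  refine (ae_restrict_iff' measurableSet_Ioi).2 (Eventually.of_forall fun y hy => ?_)
  rw [norm_mul, norm_cexp_mul, Complex.neg_re]
  calc Real.exp (-z.re * y) * ‖h y‖ ≤ Real.exp (-z.re * y) * (C * Real.exp (-η * y)) := by
        gcongr; exact hC y (le_of_lt hy)
    _ = C * Real.exp (-(z.re + η) * y) := by
        rw [mul_left_comm, ← Real.exp_add]; ring_nf

lemma norm_integral_cexp_mul_le {z : ℂ} {η C : ℝ} (hz : -η < z.re) {h : ℝ → ℂ}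
    (hC : ∀ y, 0 ≤ y → ‖h y‖ ≤ C * Real.exp (-η * y)) {x : ℝ} (hx : 0 ≤ x) :
    ‖∫ y in Ioi x, Complex.exp (-z * y) * h y‖ ≤
      C / (z.re + η) * Real.exp (-(z.re + η) * x) := by
  have hlt : -(z.re + η) < 0 := by linarith
  have := norm_integral_le_of_norm_le (μ := volume.restrict (Ioi x))
    (f := fun y : ℝ => Complex.exp (-z * y) * h y)
    ((integrableOn_exp_mul_Ioi hlt x).const_mul C)
    ((ae_restrict_iff' measurableSet_Ioi).2 (Eventually.of_forall fun y hy => by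
      rw [norm_mul, norm_cexp_mul, Complex.neg_re]
      calc Real.exp (-z.re * y) * ‖h y‖ ≤ Real.exp (-z.re * y) * (C * Real.exp (-η * y)) := by
            gcongr; exact hC y (hx.trans (le_of_lt hy))
        _ = C * Real.exp (-(z.re + η) * y) := by
            rw [mul_left_comm, ← Real.exp_add]; ring_nf))
  rw [integral_const_mul, integral_exp_mul_Ioi hlt] at this
  refine this.trans_eq ?_
  rw [neg_div_neg_eq]; ring

/-- Taking the Laplace transform of h at z as initial value cancels the mode e^{zx} and leaves a
tail integral. This is what gives decay even when Re z ≥ 0, where a generic solution grows. -/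
lemma duhamel_integral {z : ℂ} {η C : ℝ} (hz : -η < z.re) {h : ℝ → ℂ}
    (hh : ContinuousOn h (Ici 0)) (hC : ∀ y, 0 ≤ y → ‖h y‖ ≤ C * Real.exp (-η * y))
    {x : ℝ} (hx : 0 ≤ x) :
    duhamel z (∫ y in Ioi (0 : ℝ), Complex.exp (-z * y) * h y) h x =
      Complex.exp (z * x) * ∫ y in Ioi x, Complex.exp (-z * y) * h y := by
  have hint := integrableOn_cexp_mul hz hh hC
  have h1 := intervalIntegral.integral_interval_add_Ioi hint
    (hint.mono_set (Ioi_subset_Ioi hx))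
  unfold duhamel
  rw [← h1, add_sub_cancel_left]

lemma norm_duhamel_integral_le {z : ℂ} {η C : ℝ} (hz : -η < z.re) {h : ℝ → ℂ}
    (hh : ContinuousOn h (Ici 0)) (hC : ∀ y, 0 ≤ y → ‖h y‖ ≤ C * Real.exp (-η * y))
    {x : ℝ} (hx : 0 ≤ x) :
    ‖duhamel z (∫ y in Ioi (0 : ℝ), Complex.exp (-z * y) * h y) h x‖ ≤
      C / (z.re + η) * Real.exp (-η * x) := by
  rw [duhamel_integral hz hh hC hx, norm_mul, norm_cexp_mul]
  refine (mul_le_mul_of_nonneg_left (norm_integral_cexp_mul_le hz hC hx)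
    (Real.exp_nonneg _)).trans_eq ?_
  rw [mul_left_comm, ← Real.exp_add]; ring_nf


/-! ### The resolvent of differentiation on the half-line -/

/-- The solution of `U' = z U - σ`, `U 0 = c`, on the half-line. -/
noncomputable def evolve (z c : ℂ) (σ : HalfLineFun) : HalfLineFun :=
  fun x => duhamel z c (IciExtend σ) x

lemma IciExtend_evolve (z c : ℂ) (σ : HalfLineFun) {x : ℝ} (hx : 0 ≤ x) :
    IciExtend (evolve z c σ) x = duhamel z c (IciExtend σ) x := by
  rw [IciExtend_of_mem _ (mem_Ici.2 hx)]; rfl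

lemma continuous_IciExtend_of_continuousOn {σ : HalfLineFun}
    (h : ContinuousOn (IciExtend σ) (Ici 0)) : Continuous (IciExtend σ) := by
  have : IciExtend σ = fun x => IciExtend σ (max 0 x) := by
    funext x
    simp [IciExtend_apply]
  rw [this]
  exact h.comp_continuous (by fun_prop) fun x => mem_Ici.2 (le_max_left _ _)

lemma continuous_IciExtend {σ : HalfLineFun} (h : ContDiffOn ℝ 1 (IciExtend σ) (Ici 0)) :
    Continuous (IciExtend σ) := continuous_IciExtend_of_continuousOn h.continuousOn

lemma hasDerivAt_IciExtend {σ : HalfLineFun} (h : ContDiffOn ℝ 1 (IciExtend σ) (Ici 0))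
    {x : ℝ} (hx : 0 < x) : HasDerivAt (IciExtend σ) (derivHL σ x) x :=
  ((h.differentiableOn (by norm_num) x hx.le).hasDerivWithinAt).hasDerivAt (Ici_mem_nhds hx)

lemma continuousOn_derivHL {σ : HalfLineFun} (h : ContDiffOn ℝ 1 (IciExtend σ) (Ici 0)) :
    ContinuousOn (derivHL σ) (Ici 0) :=
  h.continuousOn_derivWithin (uniqueDiffOn_Ici 0) le_rfl

lemma derivHL_eq_of_hasDerivWithinAt {σ : HalfLineFun} {f : ℝ → ℂ} {f' : ℂ}
    (hf : EqOn (IciExtend σ) f (Ici 0)) {x : ℝ} (hx : 0 ≤ x)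
    (h : HasDerivWithinAt f f' (Ici 0) x) : derivHL σ x = f' :=
  (h.congr hf (hf hx)).derivWithin (uniqueDiffOn_Ici 0 x hx)

section evolve

variable {σ : HalfLineFun} (z w c d e : ℂ)

lemma contDiffOn_evolve (h : Continuous (IciExtend σ)) :
    ContDiffOn ℝ 1 (IciExtend (evolve z c σ)) (Ici 0) := by
  have hd := fun x => hasDerivAt_duhamel z c h x
  have : ContDiff ℝ 1 (duhamel z c (IciExtend σ)) := by
    refine contDiff_one_iff_deriv.2 ⟨fun x => (hd x).differentiableAt, ?_⟩
    rw [funext fun x => (hd x).deriv]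
    exact (continuous_const.mul (continuous_duhamel z c h)).sub h
  exact this.contDiffOn.congr fun x hx => IciExtend_evolve z c σ hx

lemma derivHL_evolve (h : Continuous (IciExtend σ)) {x : ℝ} (hx : 0 ≤ x) :
    derivHL (evolve z c σ) x = z * duhamel z c (IciExtend σ) x - IciExtend σ x :=
  derivHL_eq_of_hasDerivWithinAt (fun _ hy => IciExtend_evolve z c σ hy) hx
    (hasDerivAt_duhamel z c h x).hasDerivWithinAt

/-- Differentiating the equation shows that U' solves the same problem with σ' in place of σ. Hence
U' is controlled by sup |σ'| and one initial value, although σ itself may be unbounded. -/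
lemma derivHL_evolve_eq_duhamel (h : ContDiffOn ℝ 1 (IciExtend σ) (Ici 0)) {x : ℝ}
    (hx : 0 ≤ x) : derivHL (evolve z c σ) x =
      duhamel z (z * c - IciExtend σ 0) (derivHL σ) x := by
  have hc := continuous_IciExtend h
  have := eq_duhamel (z := z) (f := fun x => z * duhamel z c (IciExtend σ) x - IciExtend σ x)
    ((continuous_const.mul (continuous_duhamel z c hc)).sub hc).continuousOn
    (continuousOn_derivHL h)
    (fun x hx => ((hasDerivAt_duhamel z c hc x).const_mul z).sub (hasDerivAt_IciExtend h hx)) hx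
  rw [derivHL_evolve z c hc hx, this, duhamel_apply_zero]

lemma evolve_sub_evolve (h : Continuous (IciExtend σ)) (he : (w - z) * e = c - d) :
    evolve z c σ - evolve w d σ = (w - z) • evolve z e (evolve w d σ) := by
  funext x
  have h1 := duhamel_sub_duhamel h he (mem_Ici.1 x.2)
  have h2 : duhamel z e (IciExtend (evolve w d σ)) x =
      duhamel z e (duhamel w d (IciExtend σ)) x :=
    duhamel_congr (fun y hy => IciExtend_evolve w d σ hy) x.2
  simp only [Pi.sub_apply, Pi.smul_apply, smul_eq_mul, evolve, h1]
  rw [← h2]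

lemma evolve_eq_add (σ : HalfLineFun) :
    evolve z c σ = evolve z 0 σ + c • evolve z 1 0 := by
  funext x
  exact duhamel_eq_add z c (IciExtend σ) x

variable {z c}

lemma norm_derivHL_evolve_le (hz : z.re < 0) (h : ContDiffOn ℝ 1 (IciExtend σ) (Ici 0)) {B : ℝ}
    (hB : ∀ x, 0 ≤ x → ‖derivHL σ x‖ ≤ B) {x : ℝ} (hx : 0 ≤ x) :
    ‖derivHL (evolve z c σ) x‖ ≤ ‖z * c - IciExtend σ 0‖ + B / (-z.re) := by
  rw [derivHL_evolve_eq_duhamel z c h hx]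
  refine (norm_duhamel_le hz hB hx).trans ?_
  gcongr
  refine mul_le_of_le_one_right (norm_nonneg _) (Real.exp_le_one_iff.2 ?_)
  exact mul_nonpos_of_nonpos_of_nonneg hz.le hx

lemma IsC1Vanishing.evolve (hz : z.re < 0) (h : IsC1Vanishing σ) :
    IsC1Vanishing (evolve z c σ) where
  contDiff := contDiffOn_evolve z c (continuous_IciExtend h.contDiff)
  tendsto_deriv := by
    refine (tendsto_duhamel (c := z * c - IciExtend σ 0) hz h.continuousOn_deriv
      h.tendsto_deriv).congr' ?_
    filter_upwards [eventually_ge_atTop 0] with x hx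
    rw [derivHL_evolve_eq_duhamel z c h.contDiff hx]

/-- Integrate U' = zU - σ against e^{-sx}. The boundary term at infinity vanishes because the
product and its derivative are both integrable. -/
lemma sub_mul_laplace_evolve {s : ℂ} (h : Continuous (IciExtend σ))
    (hσ : IntegrableOn (fun x : ℝ => IciExtend σ x * Complex.exp (-s * x)) (Ioi 0))
    (hU : IntegrableOn
      (fun x : ℝ => IciExtend (evolve z c σ) x * Complex.exp (-s * x)) (Ioi 0)) :
    (s - z) * laplace (evolve z c σ) s = c - laplace σ s := by
  set D : ℝ → ℂ := duhamel z c (IciExtend σ)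
  have hD : EqOn (fun x : ℝ => IciExtend (evolve z c σ) x * Complex.exp (-s * x))
      (fun x : ℝ => D x * Complex.exp (-s * x)) (Ioi 0) := fun x hx => by
    simp only [IciExtend_evolve z c σ (le_of_lt hx), D]
  have hU' : IntegrableOn (fun x : ℝ => D x * Complex.exp (-s * x)) (Ioi 0) :=
    hU.congr_fun hD measurableSet_Ioi
  have hd : ∀ x : ℝ, HasDerivAt (fun x : ℝ => D x * Complex.exp (-s * x))
      ((z - s) * (D x * Complex.exp (-s * x)) - IciExtend σ x * Complex.exp (-s * x)) x :=
    fun x => ((hasDerivAt_duhamel z c h x).mul (hasDerivAt_cexp_mul (-s) x)).congr_deriv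
      (by ring)
  have hint := (hU'.const_mul (z - s)).sub hσ
  have h0 := tendsto_zero_of_hasDerivAt_of_integrableOn_Ioi (fun x _ => hd x) hint hU'
  have key := integral_Ioi_of_hasDerivAt_of_tendsto' (fun x _ => hd x) hint h0
  rw [integral_sub (hU'.const_mul (z - s)) hσ, integral_const_mul] at key
  have hL : laplace (LaplaceSpaces.evolve z c σ) s =
      ∫ x in Ioi (0 : ℝ), D x * Complex.exp (-s * x) :=
    setIntegral_congr_fun measurableSet_Ioi hD
  have hD0 : D 0 = c := duhamel_apply_zero _ _ _
  rw [hD0] at key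
  simp only [Complex.ofReal_zero, mul_zero, Complex.exp_zero, mul_one] at key
  rw [hL]
  unfold laplace
  linear_combination -key

lemma IsC1Vanishing.laplace_evolve (hz : z.re < 0) (h : IsC1Vanishing σ) {s : ℂ}
    (hs : 0 < s.re) :
    laplace (LaplaceSpaces.evolve z c σ) s = (c - laplace σ s) / (s - z) := by
  have hne : s - z ≠ 0 := fun h0 => by
    have := congrArg Complex.re h0
    simp at this; linarith
  rw [eq_div_iff hne, mul_comm]
  exact sub_mul_laplace_evolve (continuous_IciExtend h.contDiff) (h.integrableOn hs)
    ((h.evolve hz).integrableOn hs)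

end evolve

/-! ### Exponentially decaying functions and their transforms -/

/-- `C¹` functions that decay, together with their derivatives, like `e^{-ηx}`. -/
structure IsC1Decaying (η : ℝ) (σ : HalfLineFun) : Prop where
  contDiff : ContDiffOn ℝ 1 (IciExtend σ) (Ici 0)
  exists_bound : ∃ C, ∀ x, 0 ≤ x → ‖IciExtend σ x‖ ≤ C * Real.exp (-η * x) ∧
    ‖derivHL σ x‖ ≤ C * Real.exp (-η * x)

namespace IsC1Decaying

variable {η : ℝ} {σ : HalfLineFun}

lemma isC1Vanishing (hη : 0 < η) (h : IsC1Decaying η σ) : IsC1Vanishing σ where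
  contDiff := h.contDiff
  tendsto_deriv := by
    obtain ⟨C, hC⟩ := h.exists_bound
    have h0 : Tendsto (fun x : ℝ => C * Real.exp (-η * x)) atTop (𝓝 0) := by
      have := (Real.tendsto_exp_atBot.comp
        (tendsto_id.const_mul_atTop_of_neg (neg_lt_zero.2 hη))).const_mul C
      simpa using this
    refine squeeze_zero_norm' ?_ h0
    filter_upwards [eventually_ge_atTop 0] with x hx using (hC x hx).2

lemma laplace_eq (σ : HalfLineFun) (s : ℂ) :
    laplace σ s = ∫ y in Ioi (0 : ℝ), Complex.exp (-s * y) * IciExtend σ y := by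
  simp only [laplace, mul_comm]

lemma integrableOn (h : IsC1Decaying η σ) {s : ℂ} (hs : -η < s.re) :
    IntegrableOn (fun x : ℝ => IciExtend σ x * Complex.exp (-s * x)) (Ioi 0) := by
  obtain ⟨C, hC⟩ := h.exists_bound
  simpa only [mul_comm] using
    integrableOn_cexp_mul hs h.contDiff.continuousOn fun y hy => (hC y hy).1

lemma norm_laplace_le {C : ℝ} (hC : ∀ x, 0 ≤ x → ‖IciExtend σ x‖ ≤ C * Real.exp (-η * x))
    {s : ℂ} (hs : -η < s.re) : ‖laplace σ s‖ ≤ C / (s.re + η) := by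
  rw [laplace_eq]
  simpa using norm_integral_cexp_mul_le hs hC le_rfl

/-- With c = ℒσ(z), the initial value zc - σ(0) of U' is the transform of σ' at z. So U' is again
the decaying solution, now for σ'. -/
lemma mul_laplace_sub (h : IsC1Decaying η σ) {z : ℂ} (hz : -η < z.re) :
    z * laplace σ z - IciExtend σ 0 =
      ∫ y in Ioi (0 : ℝ), Complex.exp (-z * y) * derivHL σ y := by
  obtain ⟨C, hC⟩ := h.exists_bound
  have hi := h.integrableOn hz
  have hi' := integrableOn_cexp_mul hz (continuousOn_derivHL h.contDiff)
    fun y hy => (hC y hy).2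
  have hd : ∀ x ∈ Ioi (0 : ℝ), HasDerivAt (fun x : ℝ => IciExtend σ x * Complex.exp (-z * x))
      (Complex.exp (-z * x) * derivHL σ x - z * (IciExtend σ x * Complex.exp (-z * x))) x :=
    fun x hx => ((hasDerivAt_IciExtend h.contDiff hx).mul
      (hasDerivAt_cexp_mul (-z) x)).congr_deriv (by ring)
  have hint := hi'.sub (hi.const_mul z)
  have key := integral_Ioi_of_hasDerivAt_of_tendsto (Continuous.continuousWithinAt (by
    have := continuous_IciExtend h.contDiff; fun_prop)) hd hint
    (tendsto_zero_of_hasDerivAt_of_integrableOn_Ioi hd hint hi)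
  rw [integral_sub hi' (hi.const_mul z), integral_const_mul] at key
  simp only [Complex.ofReal_zero, mul_zero, Complex.exp_zero, mul_one] at key
  unfold laplace
  linear_combination -key

lemma norm_derivHL_evolve_le (h : IsC1Decaying η σ) {C : ℝ}
    (hC : ∀ x, 0 ≤ x → ‖derivHL σ x‖ ≤ C * Real.exp (-η * x))
    {z : ℂ} (hz : -η < z.re) {x : ℝ} (hx : 0 ≤ x) :
    ‖derivHL (evolve z (laplace σ z) σ) x‖ ≤ C / (z.re + η) * Real.exp (-η * x) := by
  rw [derivHL_evolve_eq_duhamel _ _ h.contDiff hx, h.mul_laplace_sub hz]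
  exact norm_duhamel_integral_le hz (continuousOn_derivHL h.contDiff) hC hx

lemma evolve (h : IsC1Decaying η σ) {z : ℂ} (hz : -η < z.re) :
    IsC1Decaying η (evolve z (laplace σ z) σ) where
  contDiff := contDiffOn_evolve _ _ (continuous_IciExtend h.contDiff)
  exists_bound := by
    obtain ⟨C, hC⟩ := h.exists_bound
    refine ⟨C / (z.re + η), fun x hx => ⟨?_, h.norm_derivHL_evolve_le (fun y hy => (hC y hy).2)
      hz hx⟩⟩
    rw [IciExtend_evolve _ _ _ hx, laplace_eq]
    exact norm_duhamel_integral_le hz h.contDiff.continuousOn (fun y hy => (hC y hy).1) hx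

lemma differentiableAt_laplace (h : IsC1Decaying η σ) {s : ℂ} (hs : -η < s.re) :
    DifferentiableAt ℂ (laplace σ) s := by
  obtain ⟨C, hC⟩ := h.exists_bound
  have hc := continuous_IciExtend h.contDiff
  have hC0 : 0 ≤ C := by
    have := (norm_nonneg _).trans (hC 0 le_rfl).1
    simpa using this
  set b := (s.re + η) / 2
  have hb : 0 < b := by simp only [b]; linarith
  have hlt : -(b / 2) < 0 := by linarith
  refine (hasDerivAt_integral_of_dominated_loc_of_deriv_le (x₀ := s)
    (s := Metric.ball s b) (μ := volume.restrict (Ioi (0 : ℝ)))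
    (F := fun s x => IciExtend σ x * Complex.exp (-s * x))
    (F' := fun s x => IciExtend σ x * (Complex.exp (-s * x) * -x))
    (bound := fun x => C * (2 / b) * Real.exp (-(b / 2) * x)) (Metric.ball_mem_nhds s hb)
    (Eventually.of_forall fun z => Continuous.aestronglyMeasurable (by fun_prop))
    (h.integrableOn hs) (Continuous.aestronglyMeasurable (by fun_prop))
    ((ae_restrict_iff' measurableSet_Ioi).2 (Eventually.of_forall fun x hx z hz => ?_))
    ((integrableOn_exp_mul_Ioi hlt 0).const_mul _)
    (Eventually.of_forall fun x z _ => ?_)).2.differentiableAt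
  · have hx0 : (0 : ℝ) < x := hx
    have hre : s.re - b < z.re := by
      have h1 := (Complex.abs_re_le_norm (z - s)).trans_lt (mem_ball_iff_norm.1 hz)
      rw [Complex.sub_re] at h1
      linarith [(abs_lt.1 h1).1]
    have hx1 : x ≤ 2 / b * Real.exp (b / 2 * x) := by
      have := Real.add_one_le_exp (b / 2 * x)
      calc x = 2 / b * (b / 2 * x) := by field_simp
        _ ≤ _ := by gcongr; linarith
    rw [norm_mul, norm_mul, norm_cexp_mul, norm_neg, Complex.norm_real,
      Real.norm_of_nonneg hx0.le, Complex.neg_re]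
    have hexp : Real.exp (-η * x) * Real.exp (-z.re * x) ≤ Real.exp (-b * x) := by
      rw [← Real.exp_add]
      refine Real.exp_le_exp.2 ?_
      have : b = s.re + η - b := by simp only [b]; ring
      nlinarith
    calc ‖IciExtend σ x‖ * (Real.exp (-z.re * x) * x)
        ≤ (C * Real.exp (-η * x)) * (Real.exp (-z.re * x) *
            (2 / b * Real.exp (b / 2 * x))) := by
          gcongr; exact (hC x hx0.le).1
      _ = C * (2 / b) * Real.exp (b / 2 * x) * (Real.exp (-η * x) * Real.exp (-z.re * x)) := by
          ring
      _ ≤ C * (2 / b) * Real.exp (b / 2 * x) * Real.exp (-b * x) := by gcongr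
      _ = C * (2 / b) * Real.exp (-(b / 2) * x) := by
          rw [mul_assoc _ (Real.exp _), ← Real.exp_add]; ring_nf
  · have h1 : HasDerivAt (fun s : ℂ => -s * (x : ℂ)) (-x) z := by
      simpa using ((hasDerivAt_id z).neg.mul_const (x : ℂ))
    exact (h1.cexp).const_mul _

lemma laplace_evolve (h : IsC1Decaying η σ) {z s : ℂ} (hz : -η < z.re) (hs : -η < s.re) :
    laplace (LaplaceSpaces.evolve z (laplace σ z) σ) s = -dslope (laplace σ) z s := by
  have hne : ∀ s : ℂ, -η < s.re → s ≠ z →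
      laplace (LaplaceSpaces.evolve z (laplace σ z) σ) s = -dslope (laplace σ) z s := by
    intro s hs hsz
    have := sub_mul_laplace_evolve (continuous_IciExtend h.contDiff) (h.integrableOn hs)
      ((h.evolve hz).integrableOn hs)
    have h0 := sub_ne_zero.2 hsz
    rw [dslope_of_ne _ hsz, slope_def_field]
    field_simp
    linear_combination this
  rcases ne_or_eq s z with hsz | rfl
  · exact hne s hs hsz
  -- At s = z the identity follows by continuity of both sides from the punctured neighbourhood.
  have h1 := ((h.evolve hz).differentiableAt_laplace hs).continuousAt
  have h2 : ContinuousAt (fun t => -dslope (laplace σ) s t) s :=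
    (continuousAt_dslope_same.2 (h.differentiableAt_laplace hs)).neg
  refine tendsto_nhds_unique_of_frequently_eq (h1.mono_left nhdsWithin_le_nhds)
    (h2.mono_left nhdsWithin_le_nhds) (l := 𝓝[≠] s) (Eventually.frequently ?_)
  filter_upwards [self_mem_nhdsWithin, mem_nhdsWithin_of_mem_nhds
    ((isOpen_lt continuous_const Complex.continuous_re).mem_nhds hs)] with t ht ht'
    using hne t ht' ht

end IsC1Decaying


/-! ### Analyticity of z ↦ Λ((z - D)⁻¹σ) -/

section

lemma sub_mul_neg_dslope (c : ℂ → ℂ) (w z : ℂ) : (w - z) * -dslope c w z = c z - c w := by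
  have := sub_smul_dslope c w z
  rw [smul_eq_mul] at this
  linear_combination this

/-- Two regimes: if s is within δ/2 of z, both points lie in a ball about w on which F is Lipschitz;
otherwise the denominator of the difference quotient is at least δ/2. -/
lemma eventually_norm_dslope_le {Ω K : Set ℂ} (hΩ : IsOpen Ω) {F : ℂ → ℂ}
    (hF : DifferentiableOn ℂ F Ω) (hK : IsCompact K) (hKΩ : K ⊆ Ω) {w : ℂ} (hw : w ∈ Ω) :
    ∃ M, ∀ᶠ z in 𝓝 w, ∀ s ∈ K, ‖dslope F z s‖ ≤ M := by
  have hcd : ContDiffAt ℂ 1 F w := (hF.contDiffOn hΩ).contDiffAt (hΩ.mem_nhds hw)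
  obtain ⟨C, U, hU, hC⟩ := hcd.exists_lipschitzOnWith
  obtain ⟨δ, hδ, hball⟩ := Metric.mem_nhds_iff.1 hU
  obtain ⟨B, hB⟩ := hK.exists_bound_of_continuousOn (hF.continuousOn.mono hKΩ)
  have hcont : ContinuousAt F w := hcd.continuousAt
  refine ⟨max C ((B + (‖F w‖ + 1)) / (δ / 2)), ?_⟩
  filter_upwards [Metric.ball_mem_nhds w (half_pos hδ),
    hcont.norm.eventually (gt_mem_nhds (lt_add_one ‖F w‖))] with z hz hFz s hs
  have hzU : U ∈ 𝓝 z := mem_of_superset (Metric.isOpen_ball.mem_nhds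
    (Metric.ball_subset_ball (half_le_self hδ.le) hz)) hball
  rcases eq_or_ne s z with rfl | hsz
  · rw [dslope_same]
    exact (norm_deriv_le_of_lipschitzOn hzU hC).trans (le_max_left _ _)
  have hpos : 0 < ‖s - z‖ := norm_pos_iff.2 (sub_ne_zero.2 hsz)
  rw [dslope_of_ne _ hsz, slope_def_field, norm_div]
  rcases lt_or_ge ‖s - z‖ (δ / 2) with hlt | hge
  · refine le_trans ?_ (le_max_left _ _)
    rw [div_le_iff₀ hpos]
    refine hC.norm_sub_le (hball ?_) (mem_of_mem_nhds hzU)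
    rw [mem_ball_iff_norm] at hz ⊢
    calc ‖s - w‖ = ‖(s - z) + (z - w)‖ := by ring_nf
      _ ≤ ‖s - z‖ + ‖z - w‖ := norm_add_le _ _
      _ < δ := by linarith
  · refine le_trans ?_ (le_max_right _ _)
    gcongr
    · have := (norm_nonneg _).trans (hB s hs)
      positivity
    · exact (norm_sub_le _ _).trans (add_le_add (hB s hs) hFz.le)

lemma dslope_congr_of_eventuallyEq {f g : ℂ → ℂ} {a b : ℂ} (h : f =ᶠ[𝓝 a] g) (hb : f b = g b) :
    dslope f a b = dslope g a b := by
  rcases eq_or_ne b a with rfl | hne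
  · rw [dslope_same, dslope_same, h.deriv_eq]
  · rw [dslope_of_ne _ hne, dslope_of_ne _ hne, slope_def_field, slope_def_field, hb, h.eq_of_nhds]

variable {α β r : ℝ} {Ω : Set ℂ} {σ : HalfLineFun} {F : ℂ → ℂ} {z w : ℂ}

lemma openRect_subset_closedRect (α r : ℝ) : openRect α r ⊆ closedRect α r := fun _ hs =>
  ⟨Ioo_subset_Icc_self hs.1, Ioo_subset_Icc_self hs.2⟩

lemma IsRectExtension.evolve_of_notMem (h : IsC1Vanishing σ) (hF : IsRectExtension α r σ F)
    (hz : z.re < 0) (hz' : z ∉ closedRect α r) (c : ℂ) :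
    IsRectExtension α r (evolve z c σ) (fun s => (c - F s) / (s - z)) where
  differentiableOn := (hF.differentiableOn.const_sub c).div (by fun_prop) fun _ hs =>
    sub_ne_zero.2 (ne_of_mem_of_not_mem (openRect_subset_closedRect α r hs) hz')
  continuousOn := (continuousOn_const.sub hF.continuousOn).div (by fun_prop) fun _ hs =>
    sub_ne_zero.2 (ne_of_mem_of_not_mem hs hz')
  eq_laplace s hs hs' := by rw [h.laplace_evolve hz hs', hF.eq_laplace s hs hs']

/-- `F` is an analytic continuation to `Ω` of the Laplace transform of `σ`, as seen on the
rectangle. -/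
structure IsAnalyticExtension (α r : ℝ) (Ω : Set ℂ) (σ : HalfLineFun) (F : ℂ → ℂ) : Prop where
  differentiableOn : DifferentiableOn ℂ F Ω
  eq_laplace : ∀ s ∈ openRect α r, 0 < s.re → F s = laplace σ s

lemma IsAnalyticExtension.isRectExtension (hΩ : closedRect α r ⊆ Ω)
    (hF : IsAnalyticExtension α r Ω σ F) : IsRectExtension α r σ F where
  differentiableOn := hF.differentiableOn.mono ((openRect_subset_closedRect α r).trans hΩ)
  continuousOn := hF.differentiableOn.continuousOn.mono hΩ
  eq_laplace := hF.eq_laplace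

lemma differentiableOn_neg_dslope (hΩ : IsOpen Ω) (hF : DifferentiableOn ℂ F Ω) (hw : w ∈ Ω) :
    DifferentiableOn ℂ (fun s => -dslope F w s) Ω :=
  ((Complex.differentiableOn_dslope (hΩ.mem_nhds hw)).2 hF).neg

/-- The initial value F(w) cancels the pole at w: the transform becomes (F(w) - F(s))/(s - w), a
difference quotient of F. -/
lemma IsAnalyticExtension.evolve (hΩ : IsOpen Ω)
    (h : IsC1Vanishing σ) (hF : IsAnalyticExtension α r Ω σ F) (hw : w ∈ Ω) (hw' : w.re < 0) :
    IsAnalyticExtension α r Ω (evolve w (F w) σ) (fun s => -dslope F w s) where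
  differentiableOn := differentiableOn_neg_dslope hΩ hF.differentiableOn hw
  eq_laplace s hs hs' := by
    have hne : s ≠ w := by rintro rfl; linarith
    rw [h.laplace_evolve hw' hs', ← hF.eq_laplace s hs hs', dslope_of_ne _ hne, slope_def_field,
      ← neg_div, neg_sub]

/-- An exponentially decaying function, with an analytic continuation `F` to `Ω` of its Laplace
transform. -/
structure IsDecayingPair (η : ℝ) (Ω : Set ℂ) (σ : HalfLineFun) (F : ℂ → ℂ) : Prop where
  decaying : IsC1Decaying η σ
  differentiableOn : DifferentiableOn ℂ F Ω
  eq_laplace : ∀ s : ℂ, -η < s.re → F s = laplace σ s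

namespace IsDecayingPair

variable {η : ℝ}

lemma isAnalyticExtension (hη : 0 < η) (h : IsDecayingPair η Ω σ F) :
    IsAnalyticExtension α r Ω σ F :=
  ⟨h.differentiableOn, fun s _ hs => h.eq_laplace s (by linarith)⟩

lemma evolve (hΩ : IsOpen Ω) (h : IsDecayingPair η Ω σ F) (hw : w ∈ Ω) (hw' : -η < w.re) :
    IsDecayingPair η Ω (evolve w (F w) σ) (fun s => -dslope F w s) where
  decaying := by rw [h.eq_laplace w hw']; exact h.decaying.evolve hw'
  differentiableOn := differentiableOn_neg_dslope hΩ h.differentiableOn hw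
  eq_laplace s hs := by
    rw [h.eq_laplace w hw', h.decaying.laplace_evolve hw' hs]
    congr 1
    refine dslope_congr_of_eventuallyEq ?_ (h.eq_laplace s hs)
    filter_upwards [(isOpen_lt continuous_const Complex.continuous_re).mem_nhds hw']
      with t ht using h.eq_laplace t ht

end IsDecayingPair

/-- A linear functional that is bounded with respect to the norm of `V_{α,r}`. -/
def IsBoundedFunctional (α r K : ℝ) (Λ : HalfLineFun →ₗ[ℂ] ℂ) : Prop :=
  ∀ τ F A B, IsC1Vanishing τ → IsRectExtension α r τ F → (∀ x, 0 ≤ x → ‖derivHL τ x‖ ≤ A) →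
    (∀ s ∈ closedRect α r, ‖F s‖ ≤ B) → ‖Λ τ‖ ≤ K * (A + B)

variable {Λ : HalfLineFun →ₗ[ℂ] ℂ} {K : ℝ}

/-- The resolvent identity turns the difference quotient at w into -g(z); applied again, it gives
g(z) - g(w) = (w - z) y(z). A local bound on y thus makes g continuous at w, with derivative -g(w)
for the original function. No topology on the function space is involved. -/
lemma differentiableAt_apply_evolve (hσ : Continuous (IciExtend σ)) (c : ℂ → ℂ) (w : ℂ)
    {c₁ : ℂ → ℂ} (hc₁ : ∀ z, (w - z) * c₁ z = c z - c w) {c₂ : ℂ → ℂ}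
    (hc₂ : ∀ z, (w - z) * c₂ z = c₁ z - c₁ w)
    (hb : ∃ M, ∀ᶠ z in 𝓝 w,
      ‖Λ (evolve z (c₂ z) (evolve w (c₁ w) (evolve w (c w) σ)))‖ ≤ M) :
    DifferentiableAt ℂ (fun z => Λ (evolve z (c z) σ)) w := by
  set U := evolve w (c w) σ
  have hU : Continuous (IciExtend U) := continuous_IciExtend (contDiffOn_evolve _ _ hσ)
  set g : ℂ → ℂ := fun z => Λ (evolve z (c₁ z) U)
  set y : ℂ → ℂ := fun z => Λ (evolve z (c₂ z) (evolve w (c₁ w) U))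
  have h1 : ∀ z, Λ (evolve z (c z) σ) - Λ (evolve w (c w) σ) = (w - z) * g z := fun z => by
    rw [← map_sub, evolve_sub_evolve z w (c z) (c w) (c₁ z) hσ (hc₁ z), map_smul, smul_eq_mul]
  have h2 : ∀ z, g z - g w = (w - z) * y z := fun z => by
    simp only [g, y]
    rw [← map_sub, evolve_sub_evolve z w (c₁ z) (c₁ w) (c₂ z) hU (hc₂ z), map_smul, smul_eq_mul]
  obtain ⟨M, hM⟩ := hb
  have hg : Tendsto g (𝓝 w) (𝓝 (g w)) := by
    rw [tendsto_iff_norm_sub_tendsto_zero]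
    have h0 : Tendsto (fun z => ‖w - z‖ * M) (𝓝 w) (𝓝 0) := by
      have : Continuous fun z => ‖w - z‖ * M := by fun_prop
      simpa using this.tendsto w
    refine squeeze_zero' (Eventually.of_forall fun _ => norm_nonneg _) ?_ h0
    filter_upwards [hM] with z hz
    rw [h2, norm_mul]
    gcongr
  have : HasDerivAt (fun z => Λ (evolve z (c z) σ)) (-g w) w := by
    rw [hasDerivAt_iff_tendsto_slope]
    refine (hg.neg.mono_left nhdsWithin_le_nhds).congr' ?_
    filter_upwards [self_mem_nhdsWithin] with z hz
    have := sub_ne_zero.2 hz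
    rw [slope_def_field, h1]
    field_simp
    ring
  exact this.differentiableAt

/-- If a class of pairs is stable under the resolvent at w, then a local bound for single
resolvents, applied after two such steps, bounds the second-order remainder. -/
lemma differentiableAt_apply_evolve_of_class {P : HalfLineFun → (ℂ → ℂ) → Prop}
    (hcont : ∀ σ F, P σ F → Continuous (IciExtend σ))
    (hP : ∀ σ F, P σ F → P (evolve w (F w) σ) (fun s => -dslope F w s))
    (hb : ∀ σ F, P σ F → ∃ M, ∀ᶠ z in 𝓝 w, ‖Λ (evolve z (F z) σ)‖ ≤ M) (h : P σ F) :
    DifferentiableAt ℂ (fun z => Λ (evolve z (F z) σ)) w := by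
  have h1 := hP _ _ h
  exact differentiableAt_apply_evolve (hcont _ _ h) F w (c₁ := fun s => -dslope F w s)
    (fun z => sub_mul_neg_dslope _ _ _) (fun z => sub_mul_neg_dslope _ _ _)
    (hb _ _ (hP _ _ h1))

/-- Bounds, uniform for `z` near a point of the left half-plane. -/
lemma eventually_norm_derivHL_evolve_le (h : IsC1Vanishing σ) (hw : w.re < 0)
    {c : ℂ → ℂ} (hc : ContinuousAt c w) :
    ∃ A, ∀ᶠ z in 𝓝 w, z.re < 0 ∧ ∀ x, 0 ≤ x → ‖derivHL (evolve z (c z) σ) x‖ ≤ A := by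
  obtain ⟨B, hB⟩ := h.exists_bound
  have hcont : ContinuousAt (fun z : ℂ => ‖z * c z - IciExtend σ 0‖ + B / (-z.re)) w := by
    refine ((continuousAt_id.mul hc).sub continuousAt_const).norm.add
      (continuousAt_const.div Complex.continuous_re.continuousAt.neg (by linarith))
  refine ⟨‖w * c w - IciExtend σ 0‖ + B / (-w.re) + 1, ?_⟩
  filter_upwards [(isOpen_lt Complex.continuous_re continuous_const).mem_nhds hw,
    hcont.eventually (gt_mem_nhds (lt_add_one _))] with z hz hz'
  exact ⟨hz, fun x hx => (norm_derivHL_evolve_le hz h.contDiff hB hx).trans hz'.le⟩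

lemma differentiableAt_apply_evolve_const (hΛ : IsBoundedFunctional α r K Λ)
    (h : IsC1Vanishing σ) (hF : IsRectExtension α r σ F) (hw : w.re < 0)
    (hw' : w ∉ closedRect α r) (c : ℂ) :
    DifferentiableAt ℂ (fun z => Λ (evolve z c σ)) w := by
  refine differentiableAt_apply_evolve_of_class (F := fun _ => c)
    (P := fun σ f => IsC1Vanishing σ ∧ (∃ F, IsRectExtension α r σ F) ∧ ∃ c, f = fun _ => c)
    (fun σ F h => continuous_IciExtend h.1.contDiff) ?_ ?_ ⟨h, ⟨F, hF⟩, c, rfl⟩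
  · rintro σ _ ⟨h, ⟨F, hF⟩, c, rfl⟩
    -- The difference quotient of a constant vanishes, so the class of pairs with constant initial
    -- value is stable, the new constant being 0.
    refine ⟨h.evolve hw, ⟨_, hF.evolve_of_notMem h hw hw' c⟩, 0, ?_⟩
    funext s
    rcases eq_or_ne s w with rfl | hs
    · simp
    · simp [dslope_of_ne _ hs, slope_def_field]
  · rintro σ _ ⟨h, ⟨F, hF⟩, c, rfl⟩
    obtain ⟨A, hA⟩ := eventually_norm_derivHL_evolve_le h hw (c := fun _ => c) continuousAt_const
    obtain ⟨B, hB⟩ := (isCompact_closedRect α r).exists_bound_of_continuousOn hF.continuousOn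
    have hopen : (closedRect α r)ᶜ ∈ 𝓝 w :=
      (isCompact_closedRect α r).isClosed.isOpen_compl.mem_nhds hw'
    obtain ⟨δ, hδ, hball⟩ := Metric.mem_nhds_iff.1 hopen
    refine ⟨K * (A + (‖c‖ + B) / (δ / 2)), ?_⟩
    filter_upwards [hA, hopen, Metric.ball_mem_nhds w (half_pos hδ)] with z hz hz' hzδ
    refine hΛ _ _ _ _ (h.evolve hz.1) (hF.evolve_of_notMem h hz.1 hz' c) hz.2 fun s hs => ?_
    rw [norm_div]
    have h1 : δ ≤ ‖s - w‖ := by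
      by_contra! hlt
      exact hball (mem_ball_iff_norm.2 hlt) hs
    have h2 : δ / 2 ≤ ‖s - z‖ := by
      rw [mem_ball_iff_norm] at hzδ
      have : ‖s - w‖ ≤ ‖s - z‖ + ‖z - w‖ := by
        simpa using norm_add_le (s - z) (z - w)
      linarith
    have h3 := (norm_nonneg _).trans (hB s hs)
    gcongr
    exact (norm_sub_le _ _).trans (add_le_add le_rfl (hB s hs))

lemma differentiableAt_apply_evolve_left (hΛ : IsBoundedFunctional α r K Λ) (hΩ : IsOpen Ω)
    (hR : closedRect α r ⊆ Ω) (h : IsC1Vanishing σ) (hF : IsAnalyticExtension α r Ω σ F)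
    (hw : w ∈ Ω) (hw' : w.re < 0) :
    DifferentiableAt ℂ (fun z => Λ (evolve z (F z) σ)) w := by
  refine differentiableAt_apply_evolve_of_class
    (P := fun σ F => IsC1Vanishing σ ∧ IsAnalyticExtension α r Ω σ F)
    (fun σ F h => continuous_IciExtend h.1.contDiff)
    (fun σ F h => ⟨h.1.evolve hw', h.2.evolve hΩ h.1 hw hw'⟩) ?_ ⟨h, hF⟩
  rintro σ F ⟨h, hF⟩
  obtain ⟨A, hA⟩ := eventually_norm_derivHL_evolve_le h hw'
    (hF.differentiableOn.continuousOn.continuousAt (hΩ.mem_nhds hw))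
  obtain ⟨M, hM⟩ := eventually_norm_dslope_le hΩ hF.differentiableOn (isCompact_closedRect α r)
    hR hw
  refine ⟨K * (A + M), ?_⟩
  filter_upwards [hA, hM, hΩ.mem_nhds hw] with z hz hz' hzΩ
  exact hΛ _ _ _ _ (h.evolve hz.1) ((hF.evolve hΩ h hzΩ hz.1).isRectExtension hR) hz.2
    fun s hs => by rw [norm_neg]; exact hz' s hs

lemma IsDecayingPair.norm_apply_evolve_le {η : ℝ} (hη : 0 < η)
    (hΛ : IsBoundedFunctional α r K Λ) (hΩ : IsOpen Ω)
    (hR : closedRect α r ⊆ Ω) (h : IsDecayingPair η Ω σ F) {C M : ℝ}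
    (hC : ∀ x, 0 ≤ x → ‖derivHL σ x‖ ≤ C * Real.exp (-η * x))
    (hz : z ∈ Ω) (hz' : -η < z.re) (hM : ∀ s ∈ closedRect α r, ‖dslope F z s‖ ≤ M) :
    ‖Λ (LaplaceSpaces.evolve z (F z) σ)‖ ≤ K * (C / (z.re + η) + M) := by
  have h1 := h.evolve hΩ hz hz'
  have hC0 : 0 ≤ C := by simpa using (norm_nonneg _).trans (hC 0 le_rfl)
  refine hΛ _ _ _ _ (h1.decaying.isC1Vanishing hη)
    ((h1.isAnalyticExtension hη).isRectExtension hR) (fun x hx => ?_)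
    fun s hs => by rw [norm_neg]; exact hM s hs
  rw [h.eq_laplace z hz']
  refine (h.decaying.norm_derivHL_evolve_le hC hz' hx).trans ?_
  refine mul_le_of_le_one_right (div_nonneg hC0 (by linarith)) (Real.exp_le_one_iff.2 ?_)
  exact mul_nonpos_of_nonpos_of_nonneg (by linarith) hx

/-- Covers the points with Re w ≥ 0, where U' stays bounded only through the decay of σ and the
choice c = ℒσ(z). -/
lemma differentiableAt_apply_evolve_right {η : ℝ} (hη : 0 < η)
    (hΛ : IsBoundedFunctional α r K Λ) (hΩ : IsOpen Ω) (hR : closedRect α r ⊆ Ω)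
    (h : IsDecayingPair η Ω σ F) (hw : w ∈ Ω) (hw' : -η < w.re) :
    DifferentiableAt ℂ (fun z => Λ (evolve z (F z) σ)) w := by
  refine differentiableAt_apply_evolve_of_class (P := IsDecayingPair η Ω)
    (fun σ F h => continuous_IciExtend h.decaying.contDiff)
    (fun σ F h => h.evolve hΩ hw hw') ?_ h
  intro σ F h
  obtain ⟨C, hC⟩ := h.decaying.exists_bound
  obtain ⟨M, hM⟩ := eventually_norm_dslope_le hΩ h.differentiableOn (isCompact_closedRect α r)
    hR hw
  have hcont : ContinuousAt (fun z : ℂ => K * (C / (z.re + η) + M)) w := by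
    have : w.re + η ≠ 0 := by linarith
    fun_prop (disch := assumption)
  refine ⟨K * (C / (w.re + η) + M) + 1, ?_⟩
  filter_upwards [hM, hΩ.mem_nhds hw,
    (isOpen_lt continuous_const Complex.continuous_re).mem_nhds hw',
    hcont.eventually (gt_mem_nhds (lt_add_one _))] with z hz hzΩ hz' hlt
  exact (h.norm_apply_evolve_le hη hΛ hΩ hR (fun x hx => (hC x hx).2) hzΩ hz' hz).trans hlt.le

end

/-! ### The approximate identity x(x - D)⁻¹ as x → +∞ -/

section

lemma exists_uniform_modulus {h : ℝ → ℂ} (hh : ContinuousOn h (Ici 0))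
    (h0 : Tendsto h atTop (𝓝 0)) {ε : ℝ} (hε : 0 < ε) :
    ∃ δ > 0, ∀ x y, 0 ≤ x → 0 ≤ y → |x - y| < δ → ‖h x - h y‖ < ε := by
  have hc : Continuous fun x : ℝ => h ‖x‖ :=
    hh.comp_continuous continuous_norm fun x => norm_nonneg x
  have hu : UniformContinuous fun x : ℝ => h ‖x‖ :=
    hc.uniformContinuous_of_tendsto_cocompact (h0.comp tendsto_norm_cocompact_atTop)
  obtain ⟨δ, hδ, H⟩ := Metric.uniformContinuous_iff.1 hu ε hε
  refine ⟨δ, hδ, fun x y hx hy hxy => ?_⟩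
  have := @H x y (by rwa [Real.dist_eq])
  rwa [dist_eq_norm, Real.norm_of_nonneg hx, Real.norm_of_nonneg hy] at this

/-- Uniform continuity gives ε for close points; the slope L = 2C/δ covers the points at distance at
least δ. The linear form can be integrated against e^{-xy}. -/
lemma exists_linear_modulus {h : ℝ → ℂ} (hh : ContinuousOn h (Ici 0))
    (h0 : Tendsto h atTop (𝓝 0)) {C : ℝ} (hC : ∀ x, 0 ≤ x → ‖h x‖ ≤ C) {ε : ℝ} (hε : 0 < ε) :
    ∃ L, 0 ≤ L ∧ ∀ t y, 0 ≤ t → t ≤ y → ‖h y - h t‖ ≤ ε + L * (y - t) := by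
  obtain ⟨δ, hδ, H⟩ := exists_uniform_modulus hh h0 hε
  have hC0 : 0 ≤ C := (norm_nonneg _).trans (hC 0 le_rfl)
  refine ⟨2 * C / δ, by positivity, fun t y ht hty => ?_⟩
  have hnn : 0 ≤ 2 * C / δ * (y - t) := mul_nonneg (by positivity) (by linarith)
  rcases lt_or_ge (y - t) δ with hlt | hge
  · have := H y t (ht.trans hty) ht (by rwa [abs_of_nonneg (by linarith)])
    linarith
  · have h1 := (norm_sub_le (h y) (h t)).trans (add_le_add (hC y (ht.trans hty)) (hC t ht))
    have h2 : 2 * C ≤ 2 * C / δ * (y - t) := by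
      rw [div_mul_eq_mul_div, le_div_iff₀ hδ]
      gcongr
    linarith

/-- The expression is the mean of h(y) - h(t) over y > t with respect to the probability density x
e^{-x(y - t)}, which concentrates at t as x grows. -/
lemma norm_mul_duhamel_sub_le {η C x t ε L : ℝ} (hη : 0 < η) (hx : 1 < x) {h : ℝ → ℂ}
    (hh : ContinuousOn h (Ici 0)) (hC : ∀ y, 0 ≤ y → ‖h y‖ ≤ C * Real.exp (-η * y))
    (ht : 0 ≤ t) (hL : 0 ≤ L) (hεL : ∀ y, t ≤ y → ‖h y - h t‖ ≤ ε + L * (y - t)) :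
    ‖(x : ℂ) * duhamel x (∫ y in Ioi (0 : ℝ), Complex.exp (-(x : ℂ) * y) * h y) h t - h t‖ ≤
      ε + L / (x - 1) := by
  have hx0 : (x : ℂ) ≠ 0 := by exact_mod_cast (by linarith : x ≠ 0)
  have hre : -η < (x : ℂ).re := by rw [Complex.ofReal_re]; linarith
  have hneg : (-(x : ℂ)).re < 0 := by simp; linarith
  have hint := (integrableOn_cexp_mul hre hh hC).mono_set (Ioi_subset_Ioi ht)
  have hinte : IntegrableOn (fun y : ℝ => Complex.exp (-(x : ℂ) * y) * h t) (Ioi t) :=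
    (integrableOn_exp_mul_complex_Ioi hneg t).mul_const _
  have h1 : (x : ℂ) * duhamel x (∫ y in Ioi (0 : ℝ), Complex.exp (-(x : ℂ) * y) * h y) h t - h t
      = x * Complex.exp (x * t) *
        ∫ y in Ioi t, Complex.exp (-(x : ℂ) * y) * (h y - h t) := by
    simp only [mul_sub]
    rw [duhamel_integral hre hh hC ht, integral_sub hint hinte, integral_mul_const,
      integral_exp_mul_complex_Ioi hneg]
    have := cexp_mul_cexp_neg (x : ℂ) t
    rw [neg_mul] at this
    field_simp
    linear_combination (h t) * this
  have hI1 : -x < 0 := by linarith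
  have hI2 : -(x - 1) < 0 := by linarith
  have hbd : ‖∫ y in Ioi t, Complex.exp (-(x : ℂ) * y) * (h y - h t)‖ ≤
      ∫ y in Ioi t, ((ε - L) * Real.exp (-x * y) +
        L * Real.exp (-t) * Real.exp (-(x - 1) * y)) := by
    refine norm_integral_le_of_norm_le (((integrableOn_exp_mul_Ioi hI1 t).const_mul _).add
      ((integrableOn_exp_mul_Ioi hI2 t).const_mul _))
      ((ae_restrict_iff' measurableSet_Ioi).2 (Eventually.of_forall fun y hy => ?_))
    have hy' : t ≤ y := le_of_lt hy
    have hexp : Real.exp (-t) * Real.exp (-(x - 1) * y) =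
        Real.exp (-x * y) * Real.exp (y - t) := by
      rw [← Real.exp_add, ← Real.exp_add]; ring_nf
    -- Replacing y - t by e^{y - t} - 1 keeps every integral a pure exponential; this is why x - 1
    -- appears in the bound.
    have hle : y - t ≤ Real.exp (y - t) - 1 := by linarith [Real.add_one_le_exp (y - t)]
    rw [norm_mul, norm_cexp_mul, Complex.neg_re, Complex.ofReal_re]
    calc Real.exp (-x * y) * ‖h y - h t‖
        ≤ Real.exp (-x * y) * (ε + L * (Real.exp (y - t) - 1)) := by
          gcongr
          exact (hεL y hy').trans (by gcongr)
      _ = _ := by rw [mul_assoc L, hexp]; ring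
  have hval : ∫ y in Ioi t, ((ε - L) * Real.exp (-x * y) +
      L * Real.exp (-t) * Real.exp (-(x - 1) * y)) =
      Real.exp (-x * t) * ((ε - L) / x + L / (x - 1)) := by
    rw [integral_add ((integrableOn_exp_mul_Ioi hI1 t).const_mul _)
      ((integrableOn_exp_mul_Ioi hI2 t).const_mul _), integral_const_mul, integral_const_mul,
      integral_exp_mul_Ioi hI1, integral_exp_mul_Ioi hI2]
    have : Real.exp (-t) * Real.exp (-(x - 1) * t) = Real.exp (-x * t) := by
      rw [← Real.exp_add]; ring_nf
    rw [neg_div_neg_eq, neg_div_neg_eq, ← this]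
    ring
  have hexp : Real.exp (x * t) * Real.exp (-x * t) = 1 := by rw [← Real.exp_add]; simp
  rw [h1, norm_mul, norm_mul, norm_cexp_mul, Complex.norm_real, Complex.ofReal_re,
    Real.norm_of_nonneg (by linarith)]
  calc x * Real.exp (x * t) * ‖∫ y in Ioi t, Complex.exp (-(x : ℂ) * y) * (h y - h t)‖
      ≤ x * Real.exp (x * t) * (Real.exp (-x * t) * ((ε - L) / x + L / (x - 1))) := by
        gcongr; exact hbd.trans_eq hval
    _ = x * ((ε - L) / x + L / (x - 1)) := by
        linear_combination (x * ((ε - L) / x + L / (x - 1))) * hexp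
    _ = ε + L / (x - 1) := by
        have : x - 1 ≠ 0 := by linarith
        field_simp
        ring

/-! ### Vanishing of Λ on exponentials -/

variable {α β r K : ℝ} {Ω : Set ℂ} {σ : HalfLineFun} {F : ℂ → ℂ} {z w : ℂ}
  {Λ : HalfLineFun →ₗ[ℂ] ℂ}

lemma laplace_zero {s : ℂ} (hs : 0 < s.re) : laplace 0 s = 0 := by
  have := laplace_const 0 s hs
  rw [zero_div] at this
  exact this

lemma isRectExtension_zero (α r : ℝ) : IsRectExtension α r 0 0 where
  differentiableOn := differentiableOn_const 0
  continuousOn := continuousOn_const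
  eq_laplace _ _ hs := (laplace_zero hs).symm

lemma evolve_one_mem_halfPlaneSpace (hβ : β < 0) (hz : z.re < β) :
    evolve z 1 0 ∈ halfPlaneSpace β := by
  have hz0 : z.re < 0 := hz.trans hβ
  refine ⟨IsC1Vanishing.zero.evolve hz0, fun s => 1 / (s - z), ?_, fun s hs => ?_⟩
  · refine (differentiableOn_const 1).div (by fun_prop) fun s (hs : β < s.re) => ?_
    refine sub_ne_zero.2 ?_
    rintro rfl
    linarith
  · rw [IsC1Vanishing.zero.laplace_evolve hz0 hs, laplace_zero hs, sub_zero]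

lemma notMem_closedRect_of_re_lt (hz : z.re < α) : z ∉ closedRect α r :=
  fun h => not_le.2 hz h.1.1

/-- The set is the union of the half-plane Re z < α and the two quadrants above and below the
rectangle, each of which meets that half-plane. -/
lemma isPreconnected_leftHalfPlane_diff_closedRect (hα : α < 0) :
    IsPreconnected {z : ℂ | z.re < 0 ∧ z ∉ closedRect α r} := by
  have h1 : IsPreconnected {z : ℂ | z.re < α} := (convex_halfSpace_re_lt α).isPreconnected
  have h2 : IsPreconnected ({z : ℂ | z.re < 0} ∩ {z | r < z.im}) :=
    ((convex_halfSpace_re_lt 0).inter (convex_halfSpace_im_gt r)).isPreconnected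
  have h3 : IsPreconnected ({z : ℂ | z.re < 0} ∩ {z | z.im < -r}) :=
    ((convex_halfSpace_re_lt 0).inter (convex_halfSpace_im_lt (-r))).isPreconnected
  have h12 := IsPreconnected.union (⟨α - 1, r + 1⟩ : ℂ) (by simp) (by simp; linarith) h1 h2
  have h123 := IsPreconnected.union (⟨α - 1, -r - 1⟩ : ℂ) (mem_union_left _ (by simp))
    (by simp; linarith) h12 h3
  convert h123 using 1
  ext z
  simp only [closedRect, Complex.mem_reProdIm, mem_Icc, mem_ofPred_eq, mem_union, mem_inter_iff,
    not_and_or, not_le]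
  constructor
  · rintro ⟨h, (h | h) | h | h⟩
    · tauto
    · linarith
    · tauto
    · tauto
  · rintro ((h | h) | h)
    · exact ⟨by linarith, by tauto⟩
    · tauto
    · tauto

lemma isOpen_leftHalfPlane_diff_closedRect :
    IsOpen {z : ℂ | z.re < 0 ∧ z ∉ closedRect α r} :=
  (isOpen_lt Complex.continuous_re continuous_const).inter
    (isCompact_closedRect α r).isClosed.isOpen_compl

/-- z ↦ Λ(e^{zx}) is analytic on this connected set and vanishes for Re z < β, where e^{zx} belongs
to V_β; the identity theorem does the rest. -/
lemma apply_evolve_one_eq_zero (hΛ : IsBoundedFunctional α r K Λ) (hβα : β < α) (hα : α < 0)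
    (hann : ∀ τ ∈ halfPlaneSpace β, Λ τ = 0) (hz : z.re < 0) (hz' : z ∉ closedRect α r) :
    Λ (evolve z 1 0) = 0 := by
  have hd : DifferentiableOn ℂ (fun z => Λ (evolve z 1 0))
      {z : ℂ | z.re < 0 ∧ z ∉ closedRect α r} := fun w hw =>
    (differentiableAt_apply_evolve_const hΛ IsC1Vanishing.zero (isRectExtension_zero α r)
      hw.1 hw.2 1).differentiableWithinAt
  have hre : ((β - 1 : ℝ) : ℂ).re < β := by simp
  refine (hd.analyticOnNhd isOpen_leftHalfPlane_diff_closedRect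
    ).eqOn_zero_of_preconnected_of_eventuallyEq_zero
    (isPreconnected_leftHalfPlane_diff_closedRect hα) (z₀ := ((β - 1 : ℝ) : ℂ))
    ⟨by linarith, notMem_closedRect_of_re_lt (hre.trans hβα)⟩ ?_ ⟨hz, hz'⟩
  filter_upwards [(isOpen_lt Complex.continuous_re continuous_const).mem_nhds hre] with w hw
    using hann _ (evolve_one_mem_halfPlaneSpace (hβα.trans hα) hw)

lemma eq_zero_of_norm_le_mul {v : ℂ} (hK : 0 ≤ K) (h : ∀ ε > 0, ‖v‖ ≤ K * ε) : v = 0 := by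
  refine norm_le_zero_iff.1 (le_of_forall_pos_le_add fun ε hε => ?_)
  refine (h (ε / (K + 1)) (by positivity)).trans ?_
  rw [zero_add, mul_div_assoc', div_le_iff₀ (by positivity)]
  nlinarith

/-! ### The Liouville argument -/

section Liouville

variable {η : ℝ}

open Classical in
/-- The resolvent function `z ↦ Λ ((z - D)⁻¹ σ)`, continued to the whole plane. -/
noncomputable def resolventFun (Λ : HalfLineFun →ₗ[ℂ] ℂ) (Ω : Set ℂ) (σ : HalfLineFun)
    (F : ℂ → ℂ) (z : ℂ) : ℂ :=
  if z ∈ Ω then Λ (evolve z (F z) σ) else Λ (evolve z 0 σ)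

lemma resolventFun_of_mem (hz : z ∈ Ω) : resolventFun Λ Ω σ F z = Λ (evolve z (F z) σ) :=
  if_pos hz

/-- The two branches differ by F(z) Λ(e^{zx}), which is zero here. This is where the annihilation
hypothesis lets the pieces be glued. -/
lemma resolventFun_of_notMem_closedRect
    (h1 : ∀ z : ℂ, z.re < 0 → z ∉ closedRect α r → Λ (evolve z 1 0) = 0)
    (hz : z.re < 0) (hz' : z ∉ closedRect α r) :
    resolventFun Λ Ω σ F z = Λ (evolve z 0 σ) := by
  unfold resolventFun
  split_ifs with h
  · rw [evolve_eq_add, map_add, map_smul, h1 z hz hz', smul_zero, add_zero]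
  · rfl

lemma differentiable_resolventFun (hη : 0 < η)
    (hΛ : IsBoundedFunctional α r K Λ) (hΩ : IsOpen Ω) (hR : closedRect α r ⊆ Ω)
    (hΩη : ∀ z : ℂ, -η < z.re → z ∈ Ω) (h : IsDecayingPair η Ω σ F)
    (h1 : ∀ z : ℂ, z.re < 0 → z ∉ closedRect α r → Λ (evolve z 1 0) = 0) :
    Differentiable ℂ (resolventFun Λ Ω σ F) := by
  have hc := h.decaying.isC1Vanishing hη
  have hF := h.isAnalyticExtension (α := α) (r := r) hη
  intro w
  by_cases hw : w ∈ Ω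
  · have hd : DifferentiableAt ℂ (fun z => Λ (evolve z (F z) σ)) w := by
      rcases lt_or_ge w.re 0 with hre | hre
      · exact differentiableAt_apply_evolve_left hΛ hΩ hR hc hF hw hre
      · exact differentiableAt_apply_evolve_right hη hΛ hΩ hR h hw (by linarith)
    refine hd.congr_of_eventuallyEq ?_
    filter_upwards [hΩ.mem_nhds hw] with z hz using resolventFun_of_mem hz
  · have hre : w.re < 0 := by
      by_contra! hre
      exact hw (hΩη w (by linarith))
    have hw' : w ∉ closedRect α r := fun h => hw (hR h)
    refine (differentiableAt_apply_evolve_const hΛ hc (hF.isRectExtension hR) hre hw'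
      0).congr_of_eventuallyEq ?_
    filter_upwards [isOpen_leftHalfPlane_diff_closedRect.mem_nhds ⟨hre, hw'⟩] with z hz
      using resolventFun_of_notMem_closedRect h1 hz.1 hz.2

lemma norm_resolventFun_le (hη : 0 < η)
    (hΛ : IsBoundedFunctional α r K Λ) (hΩ : IsOpen Ω) (hR : closedRect α r ⊆ Ω)
    (hΩη : ∀ z : ℂ, -η < z.re → z ∈ Ω) (h : IsDecayingPair η Ω σ F) {C B d : ℝ}
    (hC : ∀ x, 0 ≤ x → ‖IciExtend σ x‖ ≤ C * Real.exp (-η * x) ∧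
      ‖derivHL σ x‖ ≤ C * Real.exp (-η * x))
    (hB : ∀ s ∈ closedRect α r, ‖F s‖ ≤ B) (hz : -η < z.re) (hd : 0 < d)
    (hdz : ∀ s ∈ closedRect α r, d ≤ ‖s - z‖) :
    ‖resolventFun Λ Ω σ F z‖ ≤ K * (C / (z.re + η) + (B + C / (z.re + η)) / d) := by
  rw [resolventFun_of_mem (hΩη z hz)]
  refine h.norm_apply_evolve_le hη hΛ hΩ hR (fun x hx => (hC x hx).2) (hΩη z hz) hz
    fun s hs => ?_
  have hne : s ≠ z := by
    rintro rfl
    have := hdz s hs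
    rw [sub_self, norm_zero] at this
    linarith
  have hFz : ‖F z‖ ≤ C / (z.re + η) := by
    rw [h.eq_laplace z hz]
    exact IsC1Decaying.norm_laplace_le (fun x hx => (hC x hx).1) hz
  rw [dslope_of_ne _ hne, slope_def_field, norm_div]
  have := (norm_nonneg _).trans (hB s hs)
  have := (norm_nonneg _).trans hFz
  gcongr
  · exact (norm_sub_le _ _).trans (add_le_add (hB s hs) hFz)
  · exact hdz s hs

lemma resolventFun_eq_zero (hη : 0 < η) (hK : 0 ≤ K)
    (hΛ : IsBoundedFunctional α r K Λ) (hΩ : IsOpen Ω) (hR : closedRect α r ⊆ Ω)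
    (hΩη : ∀ z : ℂ, -η < z.re → z ∈ Ω) (h : IsDecayingPair η Ω σ F)
    (h1 : ∀ z : ℂ, z.re < 0 → z ∉ closedRect α r → Λ (evolve z 1 0) = 0) (z : ℂ) :
    resolventFun Λ Ω σ F z = 0 := by
  have hent := differentiable_resolventFun hη hΛ hΩ hR hΩη h h1
  have hc := h.decaying.isC1Vanishing hη
  have hF := (h.isAnalyticExtension (α := α) (r := r) hη).isRectExtension hR
  obtain ⟨C, hC⟩ := h.decaying.exists_bound
  have hC0 : 0 ≤ C := by simpa using (norm_nonneg _).trans (hC 0 le_rfl).1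
  obtain ⟨A, hA⟩ := hc.exists_bound
  have hA0 : 0 ≤ A := (norm_nonneg _).trans (hA 0 le_rfl)
  obtain ⟨B', hB'⟩ := (isCompact_closedRect α r).exists_bound_of_continuousOn hF.continuousOn
  obtain ⟨B, hB0, hB⟩ : ∃ B, 0 ≤ B ∧ ∀ s ∈ closedRect α r, ‖F s‖ ≤ B :=
    ⟨max B' 0, le_max_right _ _, fun s hs => (hB' s hs).trans (le_max_left _ _)⟩
  obtain ⟨ρ, hρ⟩ := (isCompact_closedRect α r).isBounded.exists_norm_le
  have hdist : ∀ z : ℂ, ∀ s ∈ closedRect α r, ‖z‖ - ρ ≤ ‖s - z‖ := fun z s hs => by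
    have := norm_sub_norm_le z s
    rw [norm_sub_rev] at this
    linarith [hρ s hs]
  have hbdd : Bornology.IsBounded (range (resolventFun Λ Ω σ F)) := by
    obtain ⟨M, hM⟩ := (isCompact_closedBall (0 : ℂ) (ρ + 1)).exists_bound_of_continuousOn
      hent.continuous.continuousOn
    -- Away from a large disc, M₁ serves for Re z > -η/2, through the decay of σ, and M₂ for Re z ≤
    -- -η/2, with initial value 0.
    set M₁ := K * (C / (η / 2) + (B + C / (η / 2)) / 1)
    set M₂ := K * (‖IciExtend σ 0‖ + A / (η / 2) + B / 1)
    refine isBounded_iff_forall_norm_le.2 ⟨max M (max M₁ M₂), ?_⟩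
    rintro _ ⟨z, rfl⟩
    rcases le_or_gt ‖z‖ (ρ + 1) with hle | hgt
    · exact (hM z (by simpa using hle)).trans (le_max_left _ _)
    refine le_trans ?_ (le_max_right _ _)
    have hd1 : ∀ s ∈ closedRect α r, 1 ≤ ‖s - z‖ := fun s hs => by linarith [hdist z s hs]
    rcases lt_or_ge (-(η / 2)) z.re with hre | hre
    · refine le_trans ?_ (le_max_left _ _)
      refine (norm_resolventFun_le hη hΛ hΩ hR hΩη h hC hB (by linarith) one_pos hd1).trans ?_
      have : η / 2 ≤ z.re + η := by linarith
      simp only [M₁]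
      gcongr
    · refine le_trans ?_ (le_max_right _ _)
      have hre0 : z.re < 0 := by linarith
      have hz' : z ∉ closedRect α r := fun hz => by linarith [hρ z hz]
      rw [resolventFun_of_notMem_closedRect h1 hre0 hz']
      refine hΛ _ _ _ _ (hc.evolve hre0) (hF.evolve_of_notMem hc hre0 hz' 0) (fun x hx => ?_)
        fun s hs => ?_
      · refine (norm_derivHL_evolve_le hre0 hc.contDiff hA hx).trans ?_
        rw [mul_zero, zero_sub, norm_neg]
        have : η / 2 ≤ -z.re := by linarith
        gcongr
      · rw [zero_sub, norm_div, norm_neg]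
        gcongr
        · exact hB s hs
        · exact hd1 s hs
  have hconst := hent.apply_eq_apply_of_bounded hbdd z
  have hlim : Tendsto (fun x : ℝ => K * (C / (x + η) + (B + C / (x + η)) / (x - ρ)))
      atTop (𝓝 0) := by
    have h2 : Tendsto (fun x : ℝ => C / (x + η)) atTop (𝓝 0) :=
      tendsto_const_nhds.div_atTop (tendsto_atTop_add_const_right _ _ tendsto_id)
    have h3 : Tendsto (fun x : ℝ => x - ρ) atTop atTop :=
      tendsto_atTop_add_const_right _ _ tendsto_id
    have := (h2.add ((tendsto_const_nhds (x := B)).add h2 |>.div_atTop h3)).const_mul K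
    simpa using this
  refine norm_le_zero_iff.1 (ge_of_tendsto hlim ?_)
  filter_upwards [eventually_gt_atTop ρ, eventually_gt_atTop 0] with x hx hx0
  rw [hconst x]
  have := norm_resolventFun_le (z := x) hη hΛ hΩ hR hΩη h hC hB
    (by rw [Complex.ofReal_re]; linarith) (sub_pos.2 hx) fun s hs => by
      simpa [abs_of_pos hx0] using hdist x s hs
  simpa using this

/-- Since Λ(x(x - D)⁻¹σ) = 0 for large x, Λσ is bounded by ‖Λ‖ times the distance of x(x - D)⁻¹σ
from σ, which tends to 0. -/
lemma apply_eq_zero_of_isDecayingPair (hη : 0 < η) (hK : 0 ≤ K)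
    (hΛ : IsBoundedFunctional α r K Λ) (hΩ : IsOpen Ω) (hR : closedRect α r ⊆ Ω)
    (hΩη : ∀ z : ℂ, -η < z.re → z ∈ Ω) (h : IsDecayingPair η Ω σ F)
    (h1 : ∀ z : ℂ, z.re < 0 → z ∉ closedRect α r → Λ (evolve z 1 0) = 0) :
    Λ σ = 0 := by
  have hc := h.decaying.isC1Vanishing hη
  have hF := (h.isAnalyticExtension (α := α) (r := r) hη).isRectExtension hR
  obtain ⟨C, hC⟩ := h.decaying.exists_bound
  obtain ⟨A, hA⟩ := hc.exists_bound
  obtain ⟨B, hB⟩ := (isCompact_closedRect α r).exists_bound_of_continuousOn hF.continuousOn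
  obtain ⟨ρ, hρ⟩ := (isCompact_closedRect α r).isBounded.exists_norm_le
  have key : ∀ ε > 0, ∃ L, ∀ x : ℝ, 1 < x → ρ < x →
      ‖Λ σ‖ ≤ K * (ε + L / (x - 1) + (C + ρ * B) / (x - ρ)) := by
    intro ε hε
    obtain ⟨L, hL, hmod⟩ := exists_linear_modulus hc.continuousOn_deriv hc.tendsto_deriv hA hε
    refine ⟨L, fun x hx hxρ => ?_⟩
    have hre : -η < (x : ℂ).re := by rw [Complex.ofReal_re]; linarith
    have hxΩ := hΩη x hre
    have hU := h.evolve hΩ hxΩ hre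
    have hUc := hU.decaying.isC1Vanishing hη
    have hUF := (hU.isAnalyticExtension (α := α) (r := r) hη).isRectExtension hR
    have hzero : Λ (evolve x (F x) σ) = 0 := by
      rw [← resolventFun_of_mem hxΩ]
      exact resolventFun_eq_zero hη hK hΛ hΩ hR hΩη h h1 x
    have heq : Λ σ = -Λ ((x : ℂ) • evolve x (F x) σ + (-1 : ℂ) • σ) := by
      rw [map_add, map_smul, map_smul, hzero]; simp
    rw [heq, norm_neg]
    refine hΛ _ _ _ _ ((hUc.smul x).add (hc.smul (-1)))
      (IsRectExtension.add (hUc.smul x) (hc.smul (-1)) (hUF.smul x) (hF.smul (-1)))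
      (fun t ht => ?_) fun s hs => ?_
    · rw [derivHL_add (hUc.smul x) (hc.smul (-1)) ht, derivHL_smul, derivHL_smul,
        derivHL_evolve_eq_duhamel _ _ hc.contDiff ht, h.eq_laplace x hre,
        h.decaying.mul_laplace_sub hre, neg_one_mul, ← sub_eq_add_neg]
      exact norm_mul_duhamel_sub_le hη hx hc.continuousOn_deriv (fun y hy => (hC y hy).2) ht hL
        fun y hy => hmod t y ht hy
    · have hsx : x - ρ ≤ ‖s - x‖ := by
        have := norm_sub_norm_le (x : ℂ) s
        rw [norm_sub_rev, Complex.norm_real, Real.norm_of_nonneg (by linarith)] at this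
        linarith [hρ s hs]
      have hne : s - x ≠ 0 := norm_pos_iff.1 (by linarith)
      have hFx : ‖F x‖ ≤ C / (x + η) := by
        rw [h.eq_laplace x hre]
        simpa using IsC1Decaying.norm_laplace_le (fun y hy => (hC y hy).1) hre
      have hxF : ‖(x : ℂ) * F x‖ ≤ C := by
        rw [norm_mul, Complex.norm_real, Real.norm_of_nonneg (by linarith)]
        have hC0 : 0 ≤ C := by simpa using (norm_nonneg _).trans (hC 0 le_rfl).1
        calc x * ‖F x‖ ≤ x * (C / (x + η)) := by gcongr
          _ = C * (x / (x + η)) := by ring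
          _ ≤ C := mul_le_of_le_one_right hC0 ((div_le_one (by linarith)).2 (by linarith))
      -- On the transform side the error has a numerator bounded in x, because |x F(x)| ≤ C, and a
      -- denominator of size at least x - ρ.
      have hval : (x : ℂ) * -dslope F x s + -1 * F s = (x * F x - s * F s) / (s - x) := by
        rw [dslope_of_ne _ (sub_ne_zero.1 hne), slope_def_field]
        field_simp
        ring
      have hsF : ‖s * F s‖ ≤ ρ * B := by
        rw [norm_mul]
        have := (norm_nonneg _).trans (hρ s hs)
        gcongr
        · exact hρ s hs
        · exact hB s hs
      rw [hval, norm_div]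
      have := (norm_nonneg _).trans hxF
      have := (norm_nonneg _).trans hsF
      have : 0 < x - ρ := by linarith
      gcongr
      exact (norm_sub_le _ _).trans (add_le_add hxF hsF)
  refine eq_zero_of_norm_le_mul hK fun ε hε => ?_
  obtain ⟨L, hL⟩ := key ε hε
  have hlim : Tendsto (fun x : ℝ => K * (ε + L / (x - 1) + (C + ρ * B) / (x - ρ)))
      atTop (𝓝 (K * ε)) := by
    have hsub : ∀ a : ℝ, Tendsto (fun x : ℝ => x - a) atTop atTop := fun a =>
      tendsto_atTop_add_const_right _ _ tendsto_id
    have := (((tendsto_const_nhds (x := ε)).add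
      ((tendsto_const_nhds (x := L)).div_atTop (hsub 1))).add
      ((tendsto_const_nhds (x := C + ρ * B)).div_atTop (hsub ρ))).const_mul K
    simpa using this
  refine ge_of_tendsto hlim ?_
  filter_upwards [eventually_gt_atTop 1, eventually_gt_atTop ρ] with x hx hx' using hL x hx hx'

end Liouville

end

/-! ### Reduction of a general function to the decaying case -/

section

variable {α β r K : ℝ} {Ω : Set ℂ} {τ : HalfLineFun} {F : ℂ → ℂ} {Λ : HalfLineFun →ₗ[ℂ] ℂ}

lemma norm_apply_le_of_close (hΛ : IsBoundedFunctional α r K Λ) {σ : HalfLineFun} {G : ℂ → ℂ}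
    (h : IsC1Vanishing τ) (k : IsC1Vanishing σ) (hF : IsRectExtension α r τ F)
    (hG : IsRectExtension α r σ G) (h0 : Λ σ = 0) {A B : ℝ}
    (hA : ∀ x, 0 ≤ x → ‖derivHL τ x - derivHL σ x‖ ≤ A)
    (hB : ∀ s ∈ closedRect α r, ‖F s - G s‖ ≤ B) : ‖Λ τ‖ ≤ K * (A + B) := by
  have heq : Λ τ = Λ (τ + (-1 : ℂ) • σ) := by
    rw [map_add, map_smul, h0, smul_zero, add_zero]
  rw [heq]
  refine hΛ _ _ _ _ (h.add (k.smul (-1))) (IsRectExtension.add h (k.smul (-1)) hF (hG.smul (-1)))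
    (fun x hx => ?_) fun s hs => ?_
  · rw [derivHL_add h (k.smul (-1)) hx, derivHL_smul, neg_one_mul, ← sub_eq_add_neg]
    exact hA x hx
  · rw [neg_one_mul, ← sub_eq_add_neg]
    exact hB s hs

lemma IsC1Vanishing.exists_sublinear_growth (h : IsC1Vanishing τ) {ε : ℝ} (hε : 0 < ε) :
    ∃ A, 0 ≤ A ∧ ∀ x, 0 ≤ x → ‖IciExtend τ x‖ ≤ A + ε * x := by
  obtain ⟨N, hN⟩ := Metric.tendsto_atTop.1 h.tendsto_deriv ε hε
  set M := max N 0
  have hM : 0 ≤ M := le_max_right _ _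
  obtain ⟨A, hA⟩ := (isCompact_Icc (a := (0 : ℝ)) (b := M)).exists_bound_of_continuousOn
    (continuous_IciExtend h.contDiff).continuousOn
  have hA0 : 0 ≤ A := (norm_nonneg _).trans (hA M ⟨hM, le_rfl⟩)
  refine ⟨A, hA0, fun x hx => ?_⟩
  rcases le_total x M with hxM | hxM
  · have : 0 ≤ ε * x := by positivity
    linarith [hA x ⟨hx, hxM⟩]
  have hmv := (convex_Ici M).norm_image_sub_le_of_norm_hasDerivWithin_le (f := IciExtend τ)
    (f' := derivHL τ) (C := ε) (x := M) (y := x)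
    (fun y hy => ((h.differentiableOn y (hM.trans hy)).hasDerivWithinAt).mono
      (Ici_subset_Ici.2 hM))
    (fun y hy => by
      have := hN y ((le_max_left _ _).trans hy)
      rw [dist_zero_right] at this
      exact this.le) self_mem_Ici hxM
  rw [Real.norm_of_nonneg (by linarith)] at hmv
  have h2 := norm_le_norm_add_norm_sub' (IciExtend τ x) (IciExtend τ M)
  have h3 := hA M ⟨hM, le_rfl⟩
  nlinarith

/-! ### Damping by e^{-ηx} -/

section damp

/-- Multiplication by `e^{-ηx}`. -/
noncomputable def damp (η : ℝ) (τ : HalfLineFun) : HalfLineFun :=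
  fun x => τ x * Complex.exp (-(η : ℂ) * (x : ℝ))

variable {η : ℝ}

lemma IciExtend_damp (η : ℝ) (τ : HalfLineFun) {x : ℝ} (hx : 0 ≤ x) :
    IciExtend (damp η τ) x = IciExtend τ x * Complex.exp (-(η : ℂ) * x) := by
  rw [IciExtend_of_mem _ (mem_Ici.2 hx), IciExtend_of_mem _ (mem_Ici.2 hx)]; rfl

lemma derivHL_damp (h : IsC1Vanishing τ) {x : ℝ} (hx : 0 ≤ x) :
    derivHL (damp η τ) x =
      (derivHL τ x - η * IciExtend τ x) * Complex.exp (-(η : ℂ) * x) := by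
  refine derivHL_eq_of_hasDerivWithinAt (fun _ hy => IciExtend_damp η τ hy) hx ?_
  exact (((h.differentiableOn x hx).hasDerivWithinAt).mul
    (hasDerivAt_cexp_mul _ x).hasDerivWithinAt).congr_deriv (by unfold derivHL; ring)

lemma norm_cexp_neg_ofReal_mul (η x : ℝ) :
    ‖Complex.exp (-(η : ℂ) * x)‖ = Real.exp (-η * x) := by
  rw [norm_cexp_mul, Complex.neg_re, Complex.ofReal_re]

/-- The other half of the rate η absorbs the at most linear growth of τ. -/
lemma IsC1Vanishing.isC1Decaying_damp (h : IsC1Vanishing τ) (hη : 0 < η) :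
    IsC1Decaying (η / 2) (damp η τ) where
  contDiff := by
    have : ContDiff ℝ 1 fun x : ℝ => Complex.exp (-(η : ℂ) * x) :=
      (contDiff_const.mul Complex.ofRealCLM.contDiff).cexp
    exact (h.contDiff.mul this.contDiffOn).congr fun x hx => IciExtend_damp η τ hx
  exists_bound := by
    obtain ⟨A, hA0, hA⟩ := h.exists_sublinear_growth one_pos
    obtain ⟨C, hC⟩ := h.exists_bound
    have hC0 : 0 ≤ C := (norm_nonneg _).trans (hC 0 le_rfl)
    have hgrow : ∀ x, 0 ≤ x → ‖IciExtend τ x‖ ≤ (A + 2 / η) * Real.exp (η / 2 * x) :=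
      fun x hx => by
        have h1 := Real.add_one_le_exp (η / 2 * x)
        have h2 : 1 ≤ Real.exp (η / 2 * x) := Real.one_le_exp (by positivity)
        have h3 : x ≤ 2 / η * Real.exp (η / 2 * x) := by
          calc x = 2 / η * (η / 2 * x) := by field_simp
            _ ≤ _ := by gcongr; linarith
        nlinarith [hA x hx]
    have hexp : ∀ x : ℝ, Real.exp (η / 2 * x) * Real.exp (-η * x) = Real.exp (-(η / 2) * x) :=
      fun x => by rw [← Real.exp_add]; ring_nf
    have hA2 : 0 ≤ A + 2 / η := by positivity
    refine ⟨(A + 2 / η) + (C + η * (A + 2 / η)), fun x hx => ⟨?_, ?_⟩⟩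
    · rw [IciExtend_damp _ _ hx, norm_mul, norm_cexp_neg_ofReal_mul]
      calc ‖IciExtend τ x‖ * Real.exp (-η * x)
          ≤ ((A + 2 / η) * Real.exp (η / 2 * x)) * Real.exp (-η * x) := by
            gcongr; exact hgrow x hx
        _ = (A + 2 / η) * Real.exp (-(η / 2) * x) := by rw [mul_assoc, hexp]
        _ ≤ _ := by
          refine mul_le_mul_of_nonneg_right ?_ (Real.exp_nonneg _)
          exact le_add_of_nonneg_right (by positivity)
    · rw [derivHL_damp h hx, norm_mul, norm_cexp_neg_ofReal_mul]
      have h2 : 1 ≤ Real.exp (η / 2 * x) := Real.one_le_exp (by positivity)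
      calc ‖derivHL τ x - η * IciExtend τ x‖ * Real.exp (-η * x)
          ≤ ((C + η * (A + 2 / η)) * Real.exp (η / 2 * x)) * Real.exp (-η * x) := by
            gcongr
            refine (norm_sub_le _ _).trans ?_
            rw [norm_mul, Complex.norm_real, Real.norm_of_nonneg hη.le, add_mul, mul_assoc]
            refine add_le_add ((hC x hx).trans (le_mul_of_one_le_right hC0 h2)) ?_
            gcongr
            exact hgrow x hx
        _ = (C + η * (A + 2 / η)) * Real.exp (-(η / 2) * x) := by rw [mul_assoc, hexp]
        _ ≤ _ := by
          refine mul_le_mul_of_nonneg_right ?_ (Real.exp_nonneg _)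
          exact le_add_of_nonneg_left hA2

lemma laplace_damp (η : ℝ) (τ : HalfLineFun) (s : ℂ) :
    laplace (damp η τ) s = laplace τ (s + η) := by
  refine setIntegral_congr_fun measurableSet_Ioi fun x hx => ?_
  simp only [IciExtend_damp η τ (le_of_lt hx)]
  rw [mul_assoc, ← Complex.exp_add]
  ring_nf

/-- The error is τ'(1 - e^{-ηx}) + ητe^{-ηx}. The first term is small since τ' is small for large x;
the second since τ(x) ≤ A + εx and ηx e^{-ηx} ≤ 1. The constant D depends on ε but not on η. -/
lemma IsC1Vanishing.norm_derivHL_sub_damp_le (h : IsC1Vanishing τ) {ε : ℝ} (hε : 0 < ε) :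
    ∃ D, ∀ η, 0 < η → ∀ x, 0 ≤ x → ‖derivHL τ x - derivHL (damp η τ) x‖ ≤ 2 * ε + η * D := by
  obtain ⟨A, hA0, hA⟩ := h.exists_sublinear_growth hε
  obtain ⟨C, hC⟩ := h.exists_bound
  have hC0 : 0 ≤ C := (norm_nonneg _).trans (hC 0 le_rfl)
  obtain ⟨N, hN⟩ := Metric.tendsto_atTop.1 h.tendsto_deriv ε hε
  set M := max N 0
  have hM : 0 ≤ M := le_max_right _ _
  refine ⟨C * M + A, fun η hη x hx => ?_⟩
  set E := Real.exp (-η * x) with hE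
  have hE0 : 0 < E := Real.exp_pos _
  have hE1 : E ≤ 1 := Real.exp_le_one_iff.2 (by nlinarith)
  have hEη : 1 - E ≤ η * x := by
    have := Real.add_one_le_exp (-η * x)
    linarith
  have hEx : η * x * E ≤ 1 := by
    have h1 : η * x ≤ Real.exp (η * x) := by linarith [Real.add_one_le_exp (η * x)]
    have h2 : Real.exp (η * x) * E = 1 := by rw [hE, ← Real.exp_add]; simp
    calc η * x * E ≤ Real.exp (η * x) * E := by gcongr
      _ = 1 := h2
  have hCE : (Complex.exp (-(η : ℂ) * x)) = ((E : ℝ) : ℂ) := by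
    rw [hE]; push_cast; rfl
  have h1 : ‖derivHL τ x‖ * (1 - E) ≤ ε + η * (C * M) := by
    rcases le_total x M with hxM | hxM
    · have : ‖derivHL τ x‖ * (1 - E) ≤ C * (η * M) :=
        mul_le_mul (hC x hx) (hEη.trans (by gcongr)) (by linarith) hC0
      linarith
    · have h2 := hN x ((le_max_left _ _).trans hxM)
      rw [dist_zero_right] at h2
      have : ‖derivHL τ x‖ * (1 - E) ≤ ε * 1 :=
        mul_le_mul h2.le (by linarith) (by linarith) hε.le
      have : 0 ≤ η * (C * M) := by positivity
      linarith
  have h2 : η * ‖IciExtend τ x‖ * E ≤ ε + η * A := by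
    calc η * ‖IciExtend τ x‖ * E ≤ η * (A + ε * x) * E := by
          gcongr; exact hA x hx
      _ = η * A * E + ε * (η * x * E) := by ring
      _ ≤ η * A * 1 + ε * 1 := by gcongr
      _ = ε + η * A := by ring
  rw [derivHL_damp h hx, hCE]
  calc ‖derivHL τ x - (derivHL τ x - η * IciExtend τ x) * (E : ℂ)‖
      = ‖derivHL τ x * ((1 - E : ℝ) : ℂ) + η * IciExtend τ x * (E : ℂ)‖ := by
        push_cast; ring_nf
    _ ≤ ‖derivHL τ x‖ * (1 - E) + η * ‖IciExtend τ x‖ * E := by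
        refine (norm_add_le _ _).trans_eq ?_
        rw [norm_mul, norm_mul, norm_mul, Complex.norm_real, Complex.norm_real, Complex.norm_real,
          Real.norm_of_nonneg hη.le, Real.norm_of_nonneg hE0.le,
          Real.norm_of_nonneg (by linarith)]
    _ ≤ 2 * ε + η * (C * M + A) := by linarith

-- Damping shifts the transform by η. On the overlap of the two regions Re(s + η) > η/2 > 0, so both
-- formulas give the same integral.
open Classical in
lemma isDecayingPair_damp (h : IsC1Vanishing τ) (hη : 0 < η) (hΩ : IsOpen Ω)
    (hF : DifferentiableOn ℂ F Ω) (hL : ∀ s ∈ Ω, 0 < s.re → F s = laplace τ s) :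
    IsDecayingPair (η / 2) ({s : ℂ | -(η / 2) < s.re} ∪ {s | s + η ∈ Ω}) (damp η τ)
      (fun s => if s + η ∈ Ω then F (s + η) else laplace (damp η τ) s) where
  decaying := h.isC1Decaying_damp hη
  eq_laplace s hs := by
    split_ifs with hsΩ
    · rw [laplace_damp, hL _ hsΩ (by simp; linarith)]
    · rfl
  differentiableOn := by
    rintro w (hw | hw)
    · refine (((h.isC1Decaying_damp hη).differentiableAt_laplace
        hw).congr_of_eventuallyEq ?_).differentiableWithinAt
      filter_upwards [(isOpen_lt continuous_const Complex.continuous_re).mem_nhds hw] with s hs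
      have hs' : -(η / 2) < s.re := hs
      split_ifs with hsΩ
      · rw [laplace_damp, hL _ hsΩ (by simp; linarith)]
      · rfl
    · have hopen : {s : ℂ | s + η ∈ Ω} ∈ 𝓝 w :=
        (hΩ.preimage (continuous_add_const (η : ℂ))).mem_nhds hw
      have hd : DifferentiableAt ℂ (fun s : ℂ => F (s + η)) w :=
        (hF.differentiableAt (hΩ.mem_nhds hw)).comp w (f := fun s : ℂ => s + η) (by fun_prop)
      refine (hd.congr_of_eventuallyEq ?_).differentiableWithinAt
      filter_upwards [hopen] with s hs using if_pos hs

-- For small η the rectangle shifted by η stays in a compact neighbourhood inside Ω, on which F is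
-- uniformly continuous; hence damping changes the transform little.
open Classical in
lemma apply_eq_zero_of_differentiableOn (hK : 0 ≤ K) (hΛ : IsBoundedFunctional α r K Λ)
    (hΩ : IsOpen Ω) (hR : closedRect α r ⊆ Ω) (h : IsC1Vanishing τ)
    (hF : DifferentiableOn ℂ F Ω) (hL : ∀ s ∈ Ω, 0 < s.re → F s = laplace τ s)
    (h1 : ∀ z : ℂ, z.re < 0 → z ∉ closedRect α r → Λ (evolve z 1 0) = 0) : Λ τ = 0 := by
  obtain ⟨δ, hδ, hδΩ⟩ := (isCompact_closedRect α r).exists_cthickening_subset_open hΩ hR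
  have hcpt : IsCompact (Metric.cthickening δ (closedRect α r)) :=
    (isCompact_closedRect α r).cthickening
  have huc := hcpt.uniformContinuousOn_of_continuous (hF.continuousOn.mono hδΩ)
  have hFR : IsRectExtension α r τ F :=
    ⟨hF.mono ((openRect_subset_closedRect α r).trans hR), hF.continuousOn.mono hR,
      fun s hs hs' => hL s (hR (openRect_subset_closedRect α r hs)) hs'⟩
  refine eq_zero_of_norm_le_mul hK fun ε hε => ?_
  obtain ⟨D, hD⟩ := h.norm_derivHL_sub_damp_le (ε := ε / 4) (by positivity)
  obtain ⟨δ₁, hδ₁, hu⟩ := Metric.uniformContinuousOn_iff.1 huc (ε / 4) (by positivity)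
  obtain ⟨η, hη, hηδ, hηδ₁, hηD⟩ : ∃ η : ℝ, 0 < η ∧ η < δ ∧ η < δ₁ ∧ η * D < ε / 4 := by
    have hev : ∀ᶠ η : ℝ in 𝓝[>] 0, η * D < ε / 4 := by
      have : Tendsto (fun η : ℝ => η * D) (𝓝 0) (𝓝 0) := by
        have : Continuous fun η : ℝ => η * D := by fun_prop
        simpa using this.tendsto 0
      exact (this.eventually (gt_mem_nhds (by positivity))).filter_mono nhdsWithin_le_nhds
    obtain ⟨η, h1, h2⟩ := (hev.and (Ioo_mem_nhdsGT (lt_min hδ hδ₁))).exists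
    exact ⟨η, h2.1, h2.2.trans_le (min_le_left _ _), h2.2.trans_le (min_le_right _ _), h1⟩
  have hmem : ∀ s ∈ closedRect α r, s + η ∈ Metric.cthickening δ (closedRect α r) := fun s hs =>
    Metric.mem_cthickening_of_dist_le _ s _ _ hs (by
      simpa [dist_eq_norm, abs_of_pos hη] using hηδ.le)
  have hpair := isDecayingPair_damp h hη hΩ hF hL
  have hη2 : 0 < η / 2 := half_pos hη
  have hRη : closedRect α r ⊆ {s : ℂ | -(η / 2) < s.re} ∪ {s | s + η ∈ Ω} := fun s hs =>
    Or.inr (hδΩ (hmem s hs))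
  have hopen : IsOpen ({s : ℂ | -(η / 2) < s.re} ∪ {s | s + (η : ℂ) ∈ Ω}) :=
    (isOpen_lt continuous_const Complex.continuous_re).union
      (hΩ.preimage (continuous_add_const (η : ℂ)))
  have h0 := apply_eq_zero_of_isDecayingPair hη2 hK hΛ hopen hRη (fun z hz => Or.inl hz) hpair h1
  have := norm_apply_le_of_close hΛ h (hpair.decaying.isC1Vanishing hη2) hFR
    ((hpair.isAnalyticExtension hη2).isRectExtension hRη) h0 (hD η hη) (B := ε / 4)
    fun s hs => by
      rw [if_pos (hδΩ (hmem s hs)), ← dist_eq_norm]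
      refine (hu s (Metric.self_subset_cthickening _ hs) _ (hmem s hs) ?_).le
      simpa [dist_eq_norm, abs_of_pos hη] using hηδ₁
  refine this.trans ?_
  gcongr
  linarith

end damp

/-! ### Dilation -/

section dilate

/-- The dilation `x ↦ τ (c x)`. -/
noncomputable def dilate (c : ℝ) (τ : HalfLineFun) : HalfLineFun := fun x => IciExtend τ (c * x)

variable {c : ℝ}

lemma IciExtend_dilate (c : ℝ) (τ : HalfLineFun) {x : ℝ} (hx : 0 ≤ x) :
    IciExtend (dilate c τ) x = IciExtend τ (c * x) := by
  rw [IciExtend_of_mem _ (mem_Ici.2 hx)]; rfl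

lemma derivHL_dilate (h : IsC1Vanishing τ) (hc : 0 < c) {x : ℝ} (hx : 0 ≤ x) :
    derivHL (dilate c τ) x = c * derivHL τ (c * x) := by
  refine derivHL_eq_of_hasDerivWithinAt (fun _ hy => IciExtend_dilate c τ hy) hx ?_
  have h1 : HasDerivWithinAt (fun x : ℝ => c * x) c (Ici 0) x := by
    simpa using ((hasDerivAt_id x).const_mul c).hasDerivWithinAt
  have h2 := (h.differentiableOn (c * x) (mul_nonneg hc.le hx)).hasDerivWithinAt
  have := h2.scomp x h1 fun y hy => mul_nonneg hc.le hy
  rwa [Complex.real_smul] at this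

lemma isC1Vanishing_dilate (h : IsC1Vanishing τ) (hc : 0 < c) :
    IsC1Vanishing (dilate c τ) where
  contDiff := by
    have : ContDiffOn ℝ 1 (fun x : ℝ => c * x) (Ici 0) := by fun_prop
    exact (h.contDiff.comp this fun y hy => mul_nonneg hc.le hy).congr
      fun x hx => IciExtend_dilate c τ hx
  tendsto_deriv := by
    have := (h.tendsto_deriv.comp (tendsto_id.const_mul_atTop hc)).const_mul (c : ℂ)
    rw [mul_zero] at this
    refine this.congr' ?_
    filter_upwards [eventually_ge_atTop 0] with x hx
    rw [derivHL_dilate h hc hx]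
    rfl

lemma laplace_dilate (hc : 0 < c) (τ : HalfLineFun) (s : ℂ) :
    laplace (dilate c τ) s = (c : ℂ)⁻¹ * laplace τ (s / c) := by
  have h1 := integral_comp_mul_left_Ioi
    (fun y : ℝ => IciExtend τ y * Complex.exp (-(s / c) * y)) 0 hc
  have hc0 : (c : ℂ) ≠ 0 := by exact_mod_cast hc.ne'
  rw [mul_zero, Complex.real_smul, Complex.ofReal_inv] at h1
  unfold laplace
  rw [← h1]
  refine setIntegral_congr_fun measurableSet_Ioi fun x hx => ?_
  simp only [IciExtend_dilate c τ (le_of_lt hx)]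
  congr 2
  push_cast
  field_simp

lemma eventually_norm_derivHL_sub_dilate_le (h : IsC1Vanishing τ) {ε : ℝ}
    (hε : 0 < ε) :
    ∀ᶠ c : ℝ in 𝓝[>] 1, ∀ x, 0 ≤ x → ‖derivHL τ x - derivHL (dilate c τ) x‖ ≤ ε := by
  obtain ⟨C, hC⟩ := h.exists_bound
  obtain ⟨N, hN⟩ := Metric.tendsto_atTop.1 h.tendsto_deriv (ε / 4) (by positivity)
  obtain ⟨δ, hδ, hu⟩ := exists_uniform_modulus h.continuousOn_deriv h.tendsto_deriv
    (show 0 < ε / 4 by positivity)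
  have hlim : ∀ D : ℝ, Tendsto (fun c : ℝ => (c - 1) * D) (𝓝[>] 1) (𝓝 0) := fun D => by
    have : Continuous fun c : ℝ => (c - 1) * D := by fun_prop
    simpa using (this.tendsto 1).mono_left nhdsWithin_le_nhds
  filter_upwards [self_mem_nhdsWithin, (hlim C).eventually (gt_mem_nhds (half_pos hε)),
    (hlim N).eventually (gt_mem_nhds hδ)] with c hc1 hcC hcN x hx
  have hc1' : 1 < c := hc1
  have hcx : 0 ≤ c * x := by positivity
  have hxcx : x ≤ c * x := le_mul_of_one_le_left hx hc1'.le
  have hclose : ‖derivHL τ x - derivHL τ (c * x)‖ ≤ ε / 2 := by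
    rcases lt_or_ge x N with hxN | hxN
    · refine (hu _ _ hx hcx ?_).le.trans (by linarith)
      rw [abs_sub_comm, abs_of_nonneg (by linarith)]
      nlinarith
    · have h1 := hN x hxN
      have h2 := hN (c * x) (hxN.trans hxcx)
      rw [dist_zero_right] at h1 h2
      linarith [norm_sub_le (derivHL τ x) (derivHL τ (c * x))]
  rw [derivHL_dilate h (by linarith) hx]
  calc ‖derivHL τ x - c * derivHL τ (c * x)‖
      = ‖(derivHL τ x - derivHL τ (c * x)) - ((c - 1 : ℝ) : ℂ) * derivHL τ (c * x)‖ := by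
        push_cast; ring_nf
    _ ≤ ε / 2 + (c - 1) * C := by
        refine (norm_sub_le _ _).trans (add_le_add hclose ?_)
        rw [norm_mul, Complex.norm_real, Real.norm_of_nonneg (by linarith)]
        gcongr
        exact hC _ hcx
    _ ≤ ε := by linarith

/-- The rectangle is convex with 0 in its interior, so dividing by c > 1 moves the closed rectangle
into the open one. This is where α < 0 is used geometrically. -/
lemma div_mem_openRect (hα : α < 0) (hr : 0 < r) (hc : 1 < c) {s : ℂ} (hs : s ∈ closedRect α r) :
    s / c ∈ openRect α r := by
  obtain ⟨⟨h1, h2⟩, h3, h4⟩ := hs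
  have hc0 : 0 < c := by linarith
  refine ⟨⟨?_, ?_⟩, ?_, ?_⟩ <;>
  simp only [Complex.div_ofReal_re, Complex.div_ofReal_im]
  · rw [lt_div_iff₀ hc0]; nlinarith
  · rw [div_lt_iff₀ hc0]; linarith
  · rw [lt_div_iff₀ hc0]; nlinarith
  · rw [div_lt_iff₀ hc0]; nlinarith

lemma IsRectExtension.eventually_norm_sub_dilate_le (hα : α < 0) (hr : 0 < r)
    (hF : IsRectExtension α r τ F) {ε : ℝ} (hε : 0 < ε) :
    ∀ᶠ c : ℝ in 𝓝[>] 1, ∀ s ∈ closedRect α r, ‖F s - (c : ℂ)⁻¹ * F (s / c)‖ ≤ ε := by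
  obtain ⟨B, hB⟩ := (isCompact_closedRect α r).exists_bound_of_continuousOn hF.continuousOn
  obtain ⟨ρ, hρ⟩ := (isCompact_closedRect α r).isBounded.exists_norm_le
  have huc := (isCompact_closedRect α r).uniformContinuousOn_of_continuous hF.continuousOn
  obtain ⟨δ, hδ, hu⟩ := Metric.uniformContinuousOn_iff.1 huc (ε / 2) (by positivity)
  have hlim : ∀ D : ℝ, Tendsto (fun c : ℝ => (1 - c⁻¹) * D) (𝓝[>] 1) (𝓝 0) := fun D => by
    have : ContinuousAt (fun c : ℝ => (1 - c⁻¹) * D) 1 := by fun_prop (disch := norm_num)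
    simpa using this.tendsto.mono_left nhdsWithin_le_nhds
  filter_upwards [self_mem_nhdsWithin, (hlim B).eventually (gt_mem_nhds (half_pos hε)),
    (hlim ρ).eventually (gt_mem_nhds hδ)] with c hc1 hcB hcρ s hs
  have hc1' : 1 < c := hc1
  have hmem := openRect_subset_closedRect α r (div_mem_openRect hα hr hc1' hs)
  have hinv : 0 ≤ 1 - c⁻¹ := sub_nonneg.2 (inv_le_one_of_one_le₀ hc1'.le)
  have hnorm : ‖((1 - c⁻¹ : ℝ) : ℂ)‖ = 1 - c⁻¹ := by
    rw [Complex.norm_real, Real.norm_of_nonneg hinv]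
  have h1 : ‖F s - F (s / c)‖ ≤ ε / 2 := by
    rw [← dist_eq_norm]
    refine (hu s hs _ hmem ?_).le
    have : s - s / c = ((1 - c⁻¹ : ℝ) : ℂ) * s := by push_cast; ring
    rw [dist_eq_norm, this, norm_mul, hnorm]
    exact (mul_le_mul_of_nonneg_left (hρ s hs) hinv).trans_lt hcρ
  calc ‖F s - (c : ℂ)⁻¹ * F (s / c)‖
      = ‖(F s - F (s / c)) + ((1 - c⁻¹ : ℝ) : ℂ) * F (s / c)‖ := by push_cast; ring_nf
    _ ≤ ε / 2 + (1 - c⁻¹) * B := by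
        refine (norm_add_le _ _).trans (add_le_add h1 ?_)
        rw [norm_mul, hnorm]
        gcongr
        exact hB _ hmem
    _ ≤ ε := by linarith

end dilate

/-- The dilated function has transform F(s/c)/c, analytic on a neighbourhood of the closed
rectangle, so Λ vanishes on it; let c decrease to 1. -/
theorem apply_eq_zero_of_isRectExtension (hβα : β < α) (hα : α < 0) (hr : 0 < r) (hK : 0 ≤ K)
    (hΛ : IsBoundedFunctional α r K Λ) (hann : ∀ τ ∈ halfPlaneSpace β, Λ τ = 0)
    (h : IsC1Vanishing τ) (hF : IsRectExtension α r τ F) : Λ τ = 0 := by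
  refine eq_zero_of_norm_le_mul hK fun ε hε => ?_
  obtain ⟨c, ⟨h1, h2⟩, hc⟩ := ((eventually_norm_derivHL_sub_dilate_le h (half_pos hε)).and
    (hF.eventually_norm_sub_dilate_le hα hr (half_pos hε)) |>.and self_mem_nhdsWithin).exists
  have hc1 : 1 < c := hc
  have hc0 : 0 < c := by linarith
  set Ω : Set ℂ := {s | s / c ∈ openRect α r}
  have hΩ : IsOpen Ω := (isOpen_openRect α r).preimage (by fun_prop)
  have hR : closedRect α r ⊆ Ω := fun s hs => div_mem_openRect hα hr hc1 hs
  have hd : DifferentiableOn ℂ (fun s : ℂ => (c : ℂ)⁻¹ * F (s / c)) Ω :=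
    (hF.differentiableOn.comp (g := F) (f := fun s : ℂ => s / c) (by fun_prop)
      fun s hs => hs).const_mul _
  have hL : ∀ s ∈ Ω, 0 < s.re → (c : ℂ)⁻¹ * F (s / c) = laplace (dilate c τ) s :=
    fun s hs hs' => by
      rw [laplace_dilate hc0, hF.eq_laplace _ hs]
      rw [Complex.div_ofReal_re]
      positivity
  have h0 := apply_eq_zero_of_differentiableOn hK hΛ hΩ hR (isC1Vanishing_dilate h hc0) hd hL
    fun z hz hz' => apply_evolve_one_eq_zero hΛ hβα hα hann hz hz'
  have := norm_apply_le_of_close hΛ h (isC1Vanishing_dilate h hc0) hF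
    ⟨hd.mono ((openRect_subset_closedRect α r).trans hR), hd.continuousOn.mono hR,
      fun s hs hs' => hL s (hR (openRect_subset_closedRect α r hs)) hs'⟩ h0 h1 h2
  rwa [add_halves] at this

/-! ### The Hahn–Banach argument -/

/-- `V_β` as a linear subspace of `V_{α,r}`. -/
def halfPlaneSubmodule (α β r : ℝ) (hα : α < 0) (hr : 0 < r) :
    Submodule ℂ (RectSpace α r hα hr) where
  carrier := {τ | τ.toFun ∈ halfPlaneSpace β}
  zero_mem' := ⟨.zero, 0, differentiableOn_const 0, fun _ hs => (laplace_zero hs).symm⟩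
  add_mem' := by
    rintro τ σ ⟨h, F, hF, hFL⟩ ⟨k, G, hG, hGL⟩
    refine ⟨h.add k, fun s => F s + G s, hF.add hG, fun s hs => ?_⟩
    beta_reduce
    rw [hFL s hs, hGL s hs]
    exact (laplace_add h k hs).symm
  smul_mem' := by
    rintro c τ ⟨h, F, hF, hFL⟩
    refine ⟨h.smul c, fun s => c * F s, hF.const_mul c, fun s hs => ?_⟩
    beta_reduce
    rw [hFL s hs]
    exact (laplace_smul τ.toFun c s).symm

lemma RectSpace.norm_le_of_bounds {hα : α < 0} {hr : 0 < r} (τ : RectSpace α r hα hr)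
    (hF : IsRectExtension α r τ.toFun F) {A B : ℝ} (hA : ∀ x, 0 ≤ x → ‖derivHL τ.toFun x‖ ≤ A)
    (hB : ∀ s ∈ closedRect α r, ‖F s‖ ≤ B) : ‖τ‖ ≤ A + B := by
  have := RectSpace.nonempty_closedRect hα hr
  refine add_le_add (ciSup_le fun x => hA x x.2) (ciSup_le fun s => ?_)
  rw [τ.isExt.unique hα hr hF s.2]
  exact hB s s.2

lemma halfPlaneSpace_subset_rectSubmodule (hβα : β < α) (r : ℝ) :
    halfPlaneSpace β ⊆ rectSubmodule α r := by
  rintro τ ⟨h, F, hF, hL⟩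
  have hsub : closedRect α r ⊆ halfPlane β := fun s hs => hβα.trans_le hs.1.1
  exact ⟨h, F, hF.mono ((openRect_subset_closedRect α r).trans hsub), hF.continuousOn.mono hsub,
    fun s _ hs => hL s hs⟩

/-- A continuous functional on `V_{α,r}` that vanishes on `V_β` is zero. -/
lemma strongDual_eq_zero (hβα : β < α) (hα : α < 0) (hr : 0 < r)
    (f : StrongDual ℂ (RectSpace α r hα hr))
    (hf : ∀ τ ∈ halfPlaneSubmodule α β r hα hr, f τ = 0) (τ : RectSpace α r hα hr) : f τ = 0 := by
  let ℓ : rectSubmodule α r →ₗ[ℂ] ℂ :=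
    { toFun := fun τ => f τ, map_add' := fun x y => f.map_add x y
      map_smul' := fun c x => f.map_smul c x }
  -- A purely algebraic extension to all functions, so that Λ applies to any `evolve z c σ` without
  -- a membership proof; boundedness is only claimed on V_{α,r}.
  obtain ⟨Λ, hΛ⟩ := ℓ.exists_extend
  have hval : ∀ σ : RectSpace α r hα hr, Λ σ.toFun = f σ := fun σ => LinearMap.congr_fun hΛ σ
  have hb : IsBoundedFunctional α r ‖f‖ Λ := by
    intro σ F A B h hF hA hB
    let σ' : RectSpace α r hα hr := (⟨σ, h, F, hF⟩ : rectSubmodule α r)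
    have h1 : Λ σ = f σ' := hval σ'
    rw [h1]
    exact (f.le_opNorm σ').trans (mul_le_mul_of_nonneg_left
      (RectSpace.norm_le_of_bounds σ' hF hA hB) (norm_nonneg _))
  have hann : ∀ σ ∈ halfPlaneSpace β, Λ σ = 0 := fun σ hσ => by
    have hσ' : σ ∈ rectSubmodule α r := halfPlaneSpace_subset_rectSubmodule hβα r hσ
    exact (hval (⟨σ, hσ'⟩ : rectSubmodule α r)).trans (hf _ hσ)
  rw [← hval]
  exact apply_eq_zero_of_isRectExtension hβα hα hr (norm_nonneg f) hb hann τ.isC1 τ.isExt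

lemma dense_halfPlaneSubmodule (hβα : β < α) (hα : α < 0) (hr : 0 < r) :
    Dense (halfPlaneSubmodule α β r hα hr : Set (RectSpace α r hα hr)) := by
  set W := halfPlaneSubmodule α β r hα hr
  intro τ
  by_contra hτ
  have hconv : Convex ℝ (closure (W : Set (RectSpace α r hα hr))) := by
    let := NormedSpace.complexToReal (E := RectSpace α r hα hr)
    exact (W.restrictScalars ℝ).convex.closure
  obtain ⟨f, u, hfu, huτ⟩ := RCLike.geometric_hahn_banach_closed_point (𝕜 := ℂ) hconv
    isClosed_closure hτ
  have hW : ∀ σ ∈ W, f σ = 0 := fun σ hσ => by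
    by_contra hne
    -- A multiple of σ on which f equals u contradicts the strict separation Re f < u on the
    -- subspace.
    have := hfu ((((u : ℝ) : ℂ) / f σ) • σ) (subset_closure (W.smul_mem _ hσ))
    rw [map_smul, smul_eq_mul, div_mul_cancel₀ _ hne] at this
    simp at this
  have h0 := hfu 0 (subset_closure W.zero_mem)
  rw [strongDual_eq_zero hβα hα hr f hW τ] at huτ
  simp only [map_zero] at h0 huτ
  linarith

end

end LaplaceSpaces

theorem proposition2p2 (α β r : ℝ) (hβα : β < α) (hα : α < 0) (hr : 0 < r) :
    LaplaceSpaces.halfPlaneSpace β ⊆ LaplaceSpaces.rectSubmodule α r ∧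
    Dense {τ : LaplaceSpaces.RectSpace α r hα hr |
      τ.toFun ∈ LaplaceSpaces.halfPlaneSpace β} :=
  ⟨LaplaceSpaces.halfPlaneSpace_subset_rectSubmodule hβα r,
    LaplaceSpaces.dense_halfPlaneSubmodule hβα hα hr⟩
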